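/- Let $gr$ (resp. $mon$) be the full subcategory of the category of groups (resp. monoids) whose objects are the finitely generated free groups (resp. finitely generated free monoids), and let $Ab$ be the category of abelian groups. Both $\mathcal C = gr$ and $\mathcal C = mon$ have a null object $0$ and finite coproducts $\vee$. For a functor $F\colon \mathcal C\to Ab$ the cross-effects are defined inductively by $$cr_1F(X)=\ker\bigl(F(0)\colon F(X)\to F(0)\bigr),\qquad cr_2F(X_1,X_2)=\ker\bigl(F(X_1\vee X_2)\to F(X_1)\oplus F(X_2)\bigr),$$ where the second map is induced by the retractions $(1,0)\colon X_1\vee X_2\to X_1$ and $(0,1)\colon X_1\vee X_2\to X_2$, and, for $m\ge 3$, $$cr_mF(X_1,\dots,X_m)=cr_2\bigl(cr_{m-1}F(-,X_3,\dots,X_m)\bigr)(X_1,X_2).$$ The functor $F$ is reduced if $F(0)=0$, and polynomial of degree $\le n$ if $cr_{n+1}F=0$. Let $Pol_n(\mathcal C,Ab)$ be the full subcategory of the category of functors $\mathcal C\to Ab$ (with natural transformations as morphisms) consisting of the reduced polynomial functors of degree $\le n$. Then for every integer $n\ge 0$ there is an isomorphism of categories $$Pol_n(gr,Ab)\;\cong\;Pol_n(mon,Ab).$$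 This holds both when $gr$ and $mon$ are taken to be the standard skeletal categories, with one object for each $m\in\mathbb N$ (the free group, resp. free monoid, on $m$ letters), and when they consist of all finitely generated free groups, resp. monoids (in a fixed universe). -/

import Mathlib

open CategoryTheory CategoryTheory.Limits ZeroObject

universe v₁ v₂ u₁ u₂ u w

noncomputable section

namespace PolFun

section CrossEffects

variable {C : Type u₁} [Category.{v₁} C] [HasZeroMorphisms C] [HasZeroObject C]
  [HasBinaryCoproducts C]
variable {D : Type u₂} [Category.{v₂} D] [Abelian D]

/-- The retraction `(1, 0) : X ∨ Y ⟶ X` killing the second summand. -/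
abbrev retrFst (X Y : C) : X ⨿ Y ⟶ X := coprod.desc (𝟙 X) 0

/-- The retraction `(0, 1) : X ∨ Y ⟶ Y` killing the first summand. -/
abbrev retrSnd (X Y : C) : X ⨿ Y ⟶ Y := coprod.desc 0 (𝟙 Y)

/-- The first cross-effect `cr₁F(X) = ker (F(0) : F(X) ⟶ F(0))`. -/
def crossEffectOne (F : C ⥤ D) : C ⥤ D where
  obj X := kernel (F.map (0 : X ⟶ (0 : C)))
  map {X X'} f := kernel.map _ _ (F.map f) (𝟙 _) (by simp [← F.map_comp])
  map_id X := by ext; simp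
  map_comp f g := by ext; simp

/-- The morphism `F(X ∨ Y) ⟶ F(X) ⊕ F(Y)` whose components are induced by the retractions. -/
abbrev crossEffectTwoMap (F : C ⥤ D) (X Y : C) : F.obj (X ⨿ Y) ⟶ F.obj X ⊞ F.obj Y :=
  biprod.lift (F.map (retrFst X Y)) (F.map (retrSnd X Y))

/-- The second cross-effect `cr₂F(X, Y) = ker (F(X ∨ Y) ⟶ F(X) ⊕ F(Y))`, as a functor of its
first variable `X`. -/
def crossEffectTwo (F : C ⥤ D) (Y : C) : C ⥤ D where
  obj X := kernel (crossEffectTwoMap F X Y)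
  map {X X'} f := kernel.map _ _ (F.map (coprod.map f (𝟙 Y))) (biprod.map (F.map f) (𝟙 _)) (by
    ext <;> simp [← F.map_comp])
  map_id X := by ext; simp
  map_comp f g := by
    ext
    simp only [kernel.lift_ι, Category.assoc, kernel.lift_ι_assoc, ← F.map_comp, kernel.map]
    simp

/-- The higher cross-effects, as functors of their first variable:
`crossEffectAux F [X₂, …, Xₘ]` is `X₁ ↦ crₘF(X₁, X₂, …, Xₘ)`, defined for `m ≥ 3` by
`crₘF(X₁, …, Xₘ) = cr₂(crₘ₋₁F(-, X₃, …, Xₘ))(X₁, X₂)`. -/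
def crossEffectAux (F : C ⥤ D) : List C → (C ⥤ D)
  | [] => crossEffectOne F
  | [Y] => crossEffectTwo F Y
  | Y :: Z :: l => crossEffectTwo (crossEffectAux F (Z :: l)) Y

/-- The value `crₘF(X₁, …, Xₘ)` of the `m`-th cross-effect, where `m = l.length + 1`, `X₁ = X` and
`l = [X₂, …, Xₘ]`. -/
def crossEffect (F : C ⥤ D) (X : C) (l : List C) : D :=
  (crossEffectAux F l).obj X

/-- `F` is polynomial of degree at most `n`: the `(n+1)`-st cross-effect vanishes. -/
def IsPolynomialOfDegreeLE (n : ℕ) (F : C ⥤ D) : Prop :=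
  ∀ (X : C) (l : List C), l.length = n → IsZero (crossEffect F X l)

/-- `F` is reduced: `F(0) = 0`. -/
def IsReduced (F : C ⥤ D) : Prop :=
  IsZero (F.obj (0 : C))

variable (C D) in
/-- The property of being a reduced polynomial functor of degree at most `n`. -/
def polProperty (n : ℕ) : ObjectProperty (C ⥤ D) :=
  fun F => IsReduced F ∧ IsPolynomialOfDegreeLE n F

variable (C D) in
/-- The category of reduced polynomial functors of degree at most `n` from `C` to `D`, with all
natural transformations as morphisms. -/
abbrev Pol (n : ℕ) : Type _ := (polProperty C D n).FullSubcategory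

end CrossEffects

section Groups

/-- The category of all finitely generated free groups (in a universe), a full subcategory of the
category of groups. -/
abbrev FreeGrp : Type (u + 1) :=
  ObjectProperty.FullSubcategory
    (fun G : GrpCat.{u} => ∃ m : ℕ, Nonempty (G ≃* FreeGroup (Fin m)))

/-- The standard skeleton of the category of finitely generated free groups: the object `m : ℕ`
stands for the free group on `m` letters, and morphisms are group homomorphisms. -/
abbrev FreeGrpSk : Type :=
  InducedCategory GrpCat.{0} (fun m : ℕ => GrpCat.of (FreeGroup (Fin m)))

variable {ι : Type w} {X : ι → GrpCat.{u}}

/-- The trivial homomorphisms are the zero morphisms. -/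
instance zeroMorphismsGrp : HasZeroMorphisms (InducedCategory GrpCat.{u} X) where
  zero G H := ⟨⟨GrpCat.ofHom 1⟩⟩
  comp_zero f H := by ext; rfl
  zero_comp G {H K} f := by ext; exact map_one f.hom.hom

instance : HasZeroMorphisms FreeGrp.{u} :=
  inferInstanceAs (HasZeroMorphisms (InducedCategory GrpCat.{u} ObjectProperty.FullSubcategory.obj))

lemma hasZeroObject_grp (hX' : ∀ m : ℕ, ∃ i, Nonempty (X i ≃* FreeGroup (Fin m))) :
    HasZeroObject (InducedCategory GrpCat.{u} X) := by
  obtain ⟨i, ⟨e⟩⟩ := hX' 0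
  have : Subsingleton (X i) := e.toEquiv.subsingleton
  refine ⟨⟨i, (IsZero.iff_id_eq_zero (C := InducedCategory GrpCat.{u} X) i).2 ?_⟩⟩
  ext x
  exact Subsingleton.elim (α := X i) _ _

lemma hasBinaryCoproducts_grp (hX : ∀ i, ∃ m : ℕ, Nonempty (X i ≃* FreeGroup (Fin m)))
    (hX' : ∀ m : ℕ, ∃ i, Nonempty (X i ≃* FreeGroup (Fin m))) :
    HasBinaryCoproducts (InducedCategory GrpCat.{u} X) := by
  refine @hasBinaryCoproducts_of_hasColimit_pair _ _ ?_
  intro G H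
  obtain ⟨a, ⟨eG⟩⟩ := hX G
  obtain ⟨b, ⟨eH⟩⟩ := hX H
  obtain ⟨W, ⟨eW⟩⟩ := hX' (a + b)
  let inl : X G →* X W := eW.symm.toMonoidHom.comp
    ((FreeGroup.map (Fin.castAdd b)).comp eG.toMonoidHom)
  let inr : X H →* X W := eW.symm.toMonoidHom.comp
    ((FreeGroup.map (Fin.natAdd a)).comp eH.toMonoidHom)
  let desc {T : InducedCategory GrpCat.{u} X} (f : G ⟶ T) (g : H ⟶ T) : X W →* X T :=
    (FreeGroup.lift (Fin.addCases (fun i => f.hom.hom (eG.symm (FreeGroup.of i)))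
      (fun i => g.hom.hom (eH.symm (FreeGroup.of i))))).comp eW.toMonoidHom
  have hom_ext_of {a : ℕ} {K : GrpCat.{u}} {T : GrpCat.{u}} (e : K ≃* FreeGroup (Fin a))
      (f g : K →* T) (h : ∀ i, f (e.symm (FreeGroup.of i)) = g (e.symm (FreeGroup.of i))) :
      f = g := by
    have : f.comp e.symm.toMonoidHom = g.comp e.symm.toMonoidHom := FreeGroup.ext_hom _ _ h
    ext x
    simpa using DFunLike.congr_fun this (e x)
  refine ⟨⟨⟨BinaryCofan.mk (P := (W : InducedCategory GrpCat.{u} X))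
    ⟨GrpCat.ofHom inl⟩ ⟨GrpCat.ofHom inr⟩, ?_⟩⟩⟩
  refine BinaryCofan.isColimitMk (fun s => ⟨GrpCat.ofHom (desc s.inl s.inr)⟩) ?_ ?_ ?_
  · intro s
    refine InducedCategory.hom_ext (GrpCat.hom_ext (hom_ext_of eG _ _ fun i => ?_))
    simp [inl, desc]
  · intro s
    refine InducedCategory.hom_ext (GrpCat.hom_ext (hom_ext_of eH _ _ fun i => ?_))
    simp [inr, desc]
  · intro s m h₁ h₂
    refine InducedCategory.hom_ext (GrpCat.hom_ext (hom_ext_of eW _ _ fun i => ?_))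
    have h₁' := fun x => DFunLike.congr_fun (congrArg (fun f => f.hom.hom) h₁) x
    have h₂' := fun x => DFunLike.congr_fun (congrArg (fun f => f.hom.hom) h₂) x
    induction i using Fin.addCases with
    | left i => simpa [inl, desc] using h₁' (eG.symm (FreeGroup.of i))
    | right i => simpa [inr, desc] using h₂' (eH.symm (FreeGroup.of i))

instance : HasZeroObject FreeGrpSk := hasZeroObject_grp fun m => ⟨m, ⟨MulEquiv.refl _⟩⟩

instance : HasBinaryCoproducts FreeGrpSk :=
  hasBinaryCoproducts_grp (fun m => ⟨m, ⟨MulEquiv.refl _⟩⟩) fun m => ⟨m, ⟨MulEquiv.refl _⟩⟩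

lemma exists_freeGrp (m : ℕ) : ∃ G : FreeGrp.{u}, Nonempty (G.obj ≃* FreeGroup (Fin m)) :=
  ⟨⟨GrpCat.of (ULift.{u} (FreeGroup (Fin m))), m, ⟨MulEquiv.ulift⟩⟩, ⟨MulEquiv.ulift⟩⟩

instance : HasZeroObject FreeGrp.{u} :=
  hasZeroObject_grp (X := ObjectProperty.FullSubcategory.obj) exists_freeGrp

instance : HasBinaryCoproducts FreeGrp.{u} :=
  hasBinaryCoproducts_grp (X := ObjectProperty.FullSubcategory.obj) (fun G => G.property)
    exists_freeGrp

end Groups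

section Monoids

/-- The category of all finitely generated free monoids (in a universe), a full subcategory of the
category of monoids. -/
abbrev FreeMon : Type (u + 1) :=
  ObjectProperty.FullSubcategory
    (fun M : MonCat.{u} => ∃ m : ℕ, Nonempty (M ≃* FreeMonoid (Fin m)))

/-- The standard skeleton of the category of finitely generated free monoids: the object `m : ℕ`
stands for the free monoid on `m` letters, and morphisms are monoid homomorphisms. -/
abbrev FreeMonSk : Type :=
  InducedCategory MonCat.{0} (fun m : ℕ => MonCat.of (FreeMonoid (Fin m)))

variable {ι : Type w} {X : ι → MonCat.{u}}

/-- The trivial homomorphisms are the zero morphisms. -/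
instance zeroMorphismsMon : HasZeroMorphisms (InducedCategory MonCat.{u} X) where
  zero G H := ⟨⟨MonCat.ofHom 1⟩⟩
  comp_zero f H := by ext; rfl
  zero_comp G {H K} f := by ext; exact map_one f.hom.hom

instance : HasZeroMorphisms FreeMon.{u} :=
  inferInstanceAs (HasZeroMorphisms (InducedCategory MonCat.{u} ObjectProperty.FullSubcategory.obj))

lemma hasZeroObject_mon (hX' : ∀ m : ℕ, ∃ i, Nonempty (X i ≃* FreeMonoid (Fin m))) :
    HasZeroObject (InducedCategory MonCat.{u} X) := by
  obtain ⟨i, ⟨e⟩⟩ := hX' 0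
  have : Subsingleton (FreeMonoid (Fin 0)) := inferInstanceAs (Subsingleton (List (Fin 0)))
  have : Subsingleton (X i) := e.toEquiv.subsingleton
  refine ⟨⟨i, (IsZero.iff_id_eq_zero (C := InducedCategory MonCat.{u} X) i).2 ?_⟩⟩
  ext x
  exact Subsingleton.elim (α := X i) _ _

lemma hasBinaryCoproducts_mon (hX : ∀ i, ∃ m : ℕ, Nonempty (X i ≃* FreeMonoid (Fin m)))
    (hX' : ∀ m : ℕ, ∃ i, Nonempty (X i ≃* FreeMonoid (Fin m))) :
    HasBinaryCoproducts (InducedCategory MonCat.{u} X) := by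
  refine @hasBinaryCoproducts_of_hasColimit_pair _ _ ?_
  intro G H
  obtain ⟨a, ⟨eG⟩⟩ := hX G
  obtain ⟨b, ⟨eH⟩⟩ := hX H
  obtain ⟨W, ⟨eW⟩⟩ := hX' (a + b)
  let inl : X G →* X W := eW.symm.toMonoidHom.comp
    ((FreeMonoid.map (Fin.castAdd b)).comp eG.toMonoidHom)
  let inr : X H →* X W := eW.symm.toMonoidHom.comp
    ((FreeMonoid.map (Fin.natAdd a)).comp eH.toMonoidHom)
  let desc {T : InducedCategory MonCat.{u} X} (f : G ⟶ T) (g : H ⟶ T) : X W →* X T :=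
    (FreeMonoid.lift (Fin.addCases (fun i => f.hom.hom (eG.symm (FreeMonoid.of i)))
      (fun i => g.hom.hom (eH.symm (FreeMonoid.of i))))).comp eW.toMonoidHom
  have hom_ext_of {a : ℕ} {K : MonCat.{u}} {T : MonCat.{u}} (e : K ≃* FreeMonoid (Fin a))
      (f g : K →* T) (h : ∀ i, f (e.symm (FreeMonoid.of i)) = g (e.symm (FreeMonoid.of i))) :
      f = g := by
    have : f.comp e.symm.toMonoidHom = g.comp e.symm.toMonoidHom := FreeMonoid.hom_eq (h ·)
    ext x
    simpa using DFunLike.congr_fun this (e x)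
  refine ⟨⟨⟨BinaryCofan.mk (P := (W : InducedCategory MonCat.{u} X))
    ⟨MonCat.ofHom inl⟩ ⟨MonCat.ofHom inr⟩, ?_⟩⟩⟩
  refine BinaryCofan.isColimitMk (fun s => ⟨MonCat.ofHom (desc s.inl s.inr)⟩) ?_ ?_ ?_
  · intro s
    refine InducedCategory.hom_ext (MonCat.hom_ext (hom_ext_of eG _ _ fun i => ?_))
    simp [inl, desc]
  · intro s
    refine InducedCategory.hom_ext (MonCat.hom_ext (hom_ext_of eH _ _ fun i => ?_))
    simp [inr, desc]
  · intro s m h₁ h₂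
    refine InducedCategory.hom_ext (MonCat.hom_ext (hom_ext_of eW _ _ fun i => ?_))
    have h₁' := fun x => DFunLike.congr_fun (congrArg (fun f => f.hom.hom) h₁) x
    have h₂' := fun x => DFunLike.congr_fun (congrArg (fun f => f.hom.hom) h₂) x
    induction i using Fin.addCases with
    | left i => simpa [inl, desc] using h₁' (eG.symm (FreeMonoid.of i))
    | right i => simpa [inr, desc] using h₂' (eH.symm (FreeMonoid.of i))

instance : HasZeroObject FreeMonSk := hasZeroObject_mon fun m => ⟨m, ⟨MulEquiv.refl _⟩⟩

instance : HasBinaryCoproducts FreeMonSk :=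
  hasBinaryCoproducts_mon (fun m => ⟨m, ⟨MulEquiv.refl _⟩⟩) fun m => ⟨m, ⟨MulEquiv.refl _⟩⟩

lemma exists_freeMon (m : ℕ) : ∃ M : FreeMon.{u}, Nonempty (M.obj ≃* FreeMonoid (Fin m)) :=
  ⟨⟨MonCat.of (ULift.{u} (FreeMonoid (Fin m))), m, ⟨MulEquiv.ulift⟩⟩, ⟨MulEquiv.ulift⟩⟩

instance : HasZeroObject FreeMon.{u} :=
  hasZeroObject_mon (X := ObjectProperty.FullSubcategory.obj) exists_freeMon

instance : HasBinaryCoproducts FreeMon.{u} :=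
  hasBinaryCoproducts_mon (X := ObjectProperty.FullSubcategory.obj) (fun M => M.property)
    exists_freeMon

end Monoids

end PolFun

end

/-! The isomorphism is restriction along group completion `Φ : mon ⥤ gr`. In both categories Hom(A,
B) is a finite power of the underlying set of B, hence a monoid on which postcomposition acts by
homomorphisms. The difference F(f * g) - F(f) - F(g) factors through cr₂F, with f acting in the
first variable only. By induction, a reduced functor of degree ≤ n is therefore a polynomial map of
degree ≤ n on every Hom set (`devVanish_map`).

A polynomial map on a power of a free monoid extends uniquely to the same power of the free group.
Uniqueness is `DevVanish.eq_of_closure`. For existence, right translations act unipotently on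
polynomial maps of bounded degree, hence invertibly, so the action extends to the group completion;
letting g act on φ and evaluating at 1 gives `polyExtension`. Thus F extends to morphisms of gr.
Functoriality (`extend_comp`) and naturality (`naturality`) follow because both sides are polynomial
and agree on monoid morphisms. Precomposition substitutes into words and is not a homomorphism in
the substituted tuple; that case rests on a Leibniz rule for filtered differences
(`filteredDev_extendedTranslation_comp`).

Since `Φ` preserves coproducts, it preserves cross-effects, so restriction preserves and detects the
degree. An isomorphism, rather than an equivalence, needs `Φ` bijective on objects. This is clear
for the skeleta; in general, every set carries as many free monoid structures of rank m as free
group structures of rank m (`nonempty_freeStr_equiv`). -/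

namespace PolFun

/-! ### Polynomial maps from monoids to abelian groups, and uniqueness of extensions. -/

section Deviations

variable {H : Type*} [Monoid H] {K : Type*} [Monoid K] {A : Type*} [AddCommGroup A]
  {B : Type*} [AddCommGroup B]

/-- All `k`-fold right differences of `φ : H → A` vanish, i.e. `φ` is a polynomial map of degree
less than `k`. -/
def DevVanish : ℕ → (H → A) → Prop
  | 0, φ => ∀ x, φ x = 0
  | k + 1, φ => ∀ a, DevVanish k (fun x => φ (x * a) - φ x)

namespace DevVanish

lemma zero : ∀ k, DevVanish k (fun _ : H => (0 : A))
  | 0 => fun _ => rfl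
  | k + 1 => fun _ => by simpa using zero k

lemma add : ∀ {k} {φ ψ : H → A}, DevVanish k φ → DevVanish k ψ → DevVanish k (φ + ψ)
  | 0, _, _, h, h' => fun x => by simp [h x, h' x]
  | k + 1, φ, ψ, h, h' => fun a => by
    convert add (h a) (h' a) using 1
    funext x
    simp only [Pi.add_apply]
    abel

lemma comp_addMonoidHom (g : A →+ B) :
    ∀ {k} {φ : H → A}, DevVanish k φ → DevVanish k (fun x => g (φ x))
  | 0, _, h => fun x => by simp [h x]
  | k + 1, φ, h => fun a => by simpa using comp_addMonoidHom g (h a)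

lemma neg {k} {φ : H → A} (h : DevVanish k φ) : DevVanish k (-φ) :=
  h.comp_addMonoidHom (-AddMonoidHom.id A)

lemma sub {k} {φ ψ : H → A} (h : DevVanish k φ) (h' : DevVanish k ψ) : DevVanish k (φ - ψ) := by
  simpa [sub_eq_add_neg] using h.add h'.neg

lemma comp_monoidHom (f : K →* H) :
    ∀ {k} {φ : H → A}, DevVanish k φ → DevVanish k (fun x => φ (f x))
  | 0, _, h => fun x => h _
  | k + 1, φ, h => fun a => by simpa using comp_monoidHom f (h (f a))

lemma const (c : A) (k : ℕ) : DevVanish (k + 1) (fun _ : H => c) := fun _ => by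
  simpa using zero k

lemma succ : ∀ {k} {φ : H → A}, DevVanish k φ → DevVanish (k + 1) φ
  | 0, _, h => fun a x => by simp [h x, h (x * a)]
  | _ + 1, _, h => fun a => (h a).succ

lemma mono {k l : ℕ} (hkl : k ≤ l) {φ : H → A} (h : DevVanish k φ) : DevVanish l φ := by
  induction hkl with
  | refl => exact h
  | step _ ih => exact ih.succ

lemma translate {k} {φ : H → A} (h : DevVanish k φ) (a : H) :
    DevVanish k (fun x => φ (x * a)) := by
  cases k with
  | zero => exact fun x => h _
  | succ k =>
    convert h.add (h a).succ using 1
    funext x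
    simp

end DevVanish

/-- A polynomial map on a group that vanishes on a generating submonoid is zero. -/
lemma DevVanish.eq_zero_of_closure {G : Type*} [Group G] (j : H →* G)
    (hj : Subgroup.closure (Set.range j) = ⊤) :
    ∀ {k} {φ : G → A}, DevVanish k φ → (∀ x, φ (j x) = 0) → ∀ g, φ g = 0
  | 0, _, h, _ => h
  | k + 1, φ, h, h0 => by
    -- The difference in direction `j a` has lower degree and vanishes on the range of `j`, so by
    -- induction it is zero. Hence `φ` is invariant under the group generated by the range, that is,
    -- constant.
    have key : ∀ a, ∀ g, φ (g * j a) = φ g := fun a g => sub_eq_zero.1 <|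
      DevVanish.eq_zero_of_closure j hj (h (j a)) (fun x => by simp [h0, ← map_mul]) g
    have all : ∀ a ∈ Subgroup.closure (Set.range j), ∀ g, φ (g * a) = φ g := by
      intro a ha
      induction ha using Subgroup.closure_induction with
      | mem x hx => obtain ⟨a, rfl⟩ := hx; exact key a
      | one => simp
      | mul x y _ _ hx hy => intro g; rw [← mul_assoc, hy, hx]
      | inv x _ hx => intro g; rw [← hx (g * x⁻¹)]; simp
    intro g
    have := all g (hj ▸ Subgroup.mem_top g) 1
    rw [one_mul] at this
    rw [this, ← map_one j, h0]

lemma DevVanish.eq_of_closure {G : Type*} [Group G] (j : H →* G)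
    (hj : Subgroup.closure (Set.range j) = ⊤) {k} {φ ψ : G → A} (hφ : DevVanish k φ)
    (hψ : DevVanish k ψ) (h : ∀ x, φ (j x) = ψ (j x)) : φ = ψ :=
  funext fun g => sub_eq_zero.1 <|
    (hφ.sub hψ).eq_zero_of_closure j hj (fun x => by simp [h]) g

end Deviations

/-! ### Unipotence of right translation on polynomial maps. -/

section Translation

variable (H : Type*) [Monoid H] (A : Type*) [AddCommGroup A]

/-- The group of polynomial maps of degree less than `k`. -/
def polyMaps (k : ℕ) : AddSubgroup (H → A) where
  carrier := {φ | DevVanish k φ}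
  zero_mem' := DevVanish.zero k
  add_mem' h h' := h.add h'
  neg_mem' h := h.neg

variable {H A}

/-- Right translation on polynomial maps. -/
def translation (k : ℕ) : H →* AddMonoid.End (polyMaps H A k) where
  toFun a :=
    { toFun φ := ⟨fun x => φ.1 (x * a), φ.2.translate a⟩
      map_zero' := rfl
      map_add' _ _ := rfl }
  map_one' := by
    ext φ x
    exact congrArg φ.1 (mul_one x)
  map_mul' a b := by
    ext φ x
    exact congrArg φ.1 (mul_assoc x a b).symm

/-- Endomorphisms of `polyMaps H A k` lowering the degree by at least `j`. -/
def lowering (k j : ℕ) : AddSubgroup (AddMonoid.End (polyMaps H A k)) where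
  carrier := {T | ∀ i, ∀ φ : polyMaps H A k, DevVanish (i + j) φ.1 → DevVanish i (T φ).1}
  zero_mem' i _ _ := DevVanish.zero i
  add_mem' h h' i φ hφ := DevVanish.add (h i φ hφ) (h' i φ hφ)
  neg_mem' h i φ hφ := DevVanish.neg (h i φ hφ)

lemma lowering_antitone (k : ℕ) {i j : ℕ} (hij : i ≤ j) :
    lowering (H := H) (A := A) k j ≤ lowering k i :=
  fun _ hT l φ hφ => hT l φ (hφ.mono (by omega))

lemma mul_mem_lowering {k i j : ℕ} {S T : AddMonoid.End (polyMaps H A k)}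
    (hS : S ∈ lowering k i) (hT : T ∈ lowering k j) : S * T ∈ lowering k (i + j) :=
  fun l φ hφ => hS l _ (hT _ φ (by rwa [add_assoc]))

lemma one_mem_lowering (k : ℕ) : (1 : AddMonoid.End (polyMaps H A k)) ∈ lowering k 0 :=
  fun _ _ h => h

lemma pow_mem_lowering {k : ℕ} {T : AddMonoid.End (polyMaps H A k)} (hT : T ∈ lowering k 1) :
    ∀ n, T ^ n ∈ lowering k n
  | 0 => one_mem_lowering k
  | n + 1 => by rw [pow_succ]; exact mul_mem_lowering (pow_mem_lowering hT n) hT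

lemma eq_zero_of_mem_lowering {k : ℕ} {T : AddMonoid.End (polyMaps H A k)}
    (hT : T ∈ lowering k k) : T = 0 := by
  ext φ x
  exact hT 0 φ (by rw [zero_add]; exact φ.2) x

lemma translation_sub_one_mem (k : ℕ) (a : H) :
    translation k a - 1 ∈ lowering (H := H) (A := A) k 1 :=
  fun _ _ hφ => hφ a

lemma end_sub_one_apply {V : Type*} [AddCommGroup V] (T : AddMonoid.End V) (v : V) :
    (T - 1) v = T v - v := rfl

/-- The unipotent automorphisms of the filtered group of polynomial maps. -/
def unipotent (k : ℕ) : Subgroup (AddMonoid.End (polyMaps H A k))ˣ where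
  carrier := {u | (u : AddMonoid.End (polyMaps H A k)) - 1 ∈ lowering k 1}
  one_mem' := by simp
  mul_mem' {u v} hu hv := by
    have : ((u * v : (AddMonoid.End (polyMaps H A k))ˣ) : AddMonoid.End (polyMaps H A k)) - 1 =
      (u - 1) * (v - 1) + (u - 1) + (v - 1) := by 
      rw [Units.val_mul, mul_sub, sub_mul, sub_mul]
      simp only [mul_one, one_mul]
      abel
    change _ ∈ lowering k 1
    rw [this]
    exact add_mem (add_mem (lowering_antitone k (by omega) (mul_mem_lowering hu hv)) hu) hv
  inv_mem' {u} hu := by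
    -- From u⁻¹ = 1 - u⁻¹(u - 1): since u - 1 lowers the degree, induction on the degree shows that
    -- u⁻¹ preserves the filtration.
    have h1 : ∀ φ, (u⁻¹).1 φ = φ - (u⁻¹).1 ((u.1 - 1) φ) := fun φ => by
      have : (u⁻¹).1 (u.1 φ) = φ := congrArg (fun T : AddMonoid.End _ => T φ) u.inv_mul
      rw [end_sub_one_apply, map_sub, this]
      abel
    have h2 : ∀ i φ, DevVanish i φ.1 → DevVanish i ((u⁻¹).1 φ).1 := by
      intro i
      induction i with
      | zero =>
        intro φ hφ
        obtain rfl : φ = 0 := Subtype.ext (funext hφ)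
        rw [map_zero]
        exact DevVanish.zero 0
      | succ i ih =>
        intro φ hφ
        rw [h1]
        exact hφ.sub (ih _ (hu i φ hφ)).succ
    intro i φ hφ
    have h3 : ((u⁻¹).1 - 1) φ = -(u⁻¹).1 ((u.1 - 1) φ) := by
      rw [eq_neg_iff_add_eq_zero, end_sub_one_apply]
      nth_rw 1 [h1 φ]
      abel
    rw [h3]
    exact (h2 _ _ (hu i φ hφ)).neg

/-- Translation minus the identity is a difference operator, hence nilpotent, so translations are
invertible even when `H` has no inverses. Landing in `unipotent`, and not merely in the units, keeps
the later extension to the group degree-lowering. -/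
lemma exists_unipotent (k : ℕ) :
    ∃ ρ : H →* unipotent (H := H) (A := A) k, ∀ a, (ρ a).1.1 = translation k a := by
  have hu : ∀ a : H, IsUnit (translation (A := A) k a) := fun a => by
    have : IsNilpotent (translation (A := A) k a - 1) :=
      ⟨k, eq_zero_of_mem_lowering (pow_mem_lowering (translation_sub_one_mem k a) k)⟩
    simpa using this.isUnit_one_add
  choose U hU using hu
  refine ⟨⟨⟨fun a => ⟨U a, ?_⟩, ?_⟩, ?_⟩, fun a => hU a⟩
  · change _ ∈ lowering k 1
    rw [hU]
    exact translation_sub_one_mem k a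
  · ext1; ext1
    simp [hU]
  · intro a b
    ext1; ext1
    simp [hU]

end Translation

/-! ### Differences of functions with values in a filtered ring. -/

section Good

variable {K : Type*} [Monoid K] {R : Type*} [Ring R] (I : ℕ → AddSubgroup R)

/-- All differences of order `l ≤ k` of `θ` lie in `I (l + j)`. -/
def FilteredDev : ℕ → ℕ → (K → R) → Prop
  | 0, j, θ => ∀ x, θ x ∈ I j
  | k + 1, j, θ => (∀ x, θ x ∈ I j) ∧ ∀ a, FilteredDev k (j + 1) (fun x => θ (x * a) - θ x)

variable {I}

lemma FilteredDev.add : ∀ {k j} {θ η : K → R}, FilteredDev I k j θ → FilteredDev I k j η →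
    FilteredDev I k j (θ + η)
  | 0, _, _, _, h, h' => fun x => add_mem (h x) (h' x)
  | k + 1, j, θ, η, h, h' => ⟨fun x => add_mem (h.1 x) (h'.1 x), fun a => by
    convert (h.2 a).add (h'.2 a) using 1
    funext x
    simp only [Pi.add_apply]
    abel⟩

lemma FilteredDev.const {c : R} : ∀ (k : ℕ) {j : ℕ},
    c ∈ I j → FilteredDev I k j (fun _ : K => c)
  | 0, _, h => fun _ => h
  | k + 1, j, h => ⟨fun _ => h, fun _ => by
    simpa using FilteredDev.const k (zero_mem (I (j + 1)))⟩

lemma FilteredDev.antitone (hI : Antitone I) : ∀ {k i j : ℕ} {θ : K → R}, i ≤ j →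
    FilteredDev I k j θ → FilteredDev I k i θ
  | 0, _, _, _, hij, h => fun x => hI hij (h x)
  | _ + 1, _, _, _, hij, h => ⟨fun x => hI hij (h.1 x), fun a =>
    FilteredDev.antitone hI (by omega) (h.2 a)⟩

lemma FilteredDev.of_succ : ∀ {k j : ℕ} {θ : K → R},
    FilteredDev I (k + 1) j θ → FilteredDev I k j θ
  | 0, _, _, h => h.1
  | _ + 1, _, _, h => ⟨h.1, fun a => (h.2 a).of_succ⟩

/-- Leibniz rule: Δ(θη) = Δθ·Δη + Δθ·η + θ·Δη. -/
lemma FilteredDev.mul (hI : Antitone I)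
    (hmul : ∀ {i j a b}, a ∈ I i → b ∈ I j → a * b ∈ I (i + j)) :
    ∀ {k i j : ℕ} {θ η : K → R}, FilteredDev I k i θ → FilteredDev I k j η →
      FilteredDev I k (i + j) (θ * η)
  | 0, _, _, _, _, h, h' => fun x => hmul (h x) (h' x)
  | k + 1, i, j, θ, η, h, h' => ⟨fun x => hmul (h.1 x) (h'.1 x), fun a => by
    have h₁ := FilteredDev.mul hI hmul (h.2 a) (h'.2 a)
    have h₂ := FilteredDev.mul hI hmul (h.2 a) (h'.of_succ)
    have h₃ := FilteredDev.mul hI hmul (h.of_succ) (h'.2 a)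
    convert ((FilteredDev.antitone hI (by omega) h₁).add
      (FilteredDev.antitone hI (by omega) h₂)).add
      (FilteredDev.antitone (i := i + j + 1) hI (by omega) h₃) using 1
    funext x
    simp only [Pi.add_apply, Pi.mul_apply]
    noncomm_ring⟩

/-- The difference in direction a is θ(x)(θ(a) - 1): the same homomorphism times a constant in `I
1`. -/
lemma FilteredDev.monoidHom (hI : Antitone I)
    (hmul : ∀ {i j a b}, a ∈ I i → b ∈ I j → a * b ∈ I (i + j)) (h1 : (1 : R) ∈ I 0) (θ : K →* R)
    (hθ : ∀ a, θ a - 1 ∈ I 1) : ∀ k, FilteredDev I k 0 θ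
  | 0 => fun x => by simpa using add_mem (hI (zero_le_one) (hθ x)) h1
  | k + 1 => ⟨fun x => by simpa using add_mem (hI (zero_le_one) (hθ x)) h1, fun a => by
    have := FilteredDev.mul hI hmul (FilteredDev.monoidHom hI hmul h1 θ hθ k)
      (FilteredDev.const (K := K) k (hθ a))
    rw [add_comm] at this
    convert this using 1
    funext x
    simp [mul_sub]⟩

end Good

/-! ### Group completion of finite powers of free monoids. -/

section FreePowers

variable {α β : Type*}

/-- The canonical map from the free monoid to the free group. -/
def toFreeGroup (β : Type*) : FreeMonoid β →* FreeGroup β := FreeMonoid.lift FreeGroup.of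

@[simp]
lemma toFreeGroup_of (b : β) : toFreeGroup β (FreeMonoid.of b) = FreeGroup.of b :=
  FreeMonoid.lift_eval_of _ _

/-- The canonical map between the powers of the free monoid and of the free group. -/
def toFreeGroupPi (α β : Type*) : (α → FreeMonoid β) →* (α → FreeGroup β) :=
  (toFreeGroup β).compLeft α

@[simp]
lemma toFreeGroupPi_apply (x : α → FreeMonoid β) (i : α) :
    toFreeGroupPi α β x i = toFreeGroup β (x i) := rfl

lemma toFreeGroupPi_mulSingle [DecidableEq α] (i : α) (x : FreeMonoid β) :
    toFreeGroupPi α β (Pi.mulSingle i x) = Pi.mulSingle i (toFreeGroup β x) := by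
  ext j
  by_cases h : j = i
  · subst h; simp
  · simp [h]

/-- Elements of a finite power of a monoid are products of elements supported at one index. -/
lemma pi_mem_of_mulSingle_mem [Fintype α] [DecidableEq α] {M S : Type*} [Monoid M]
    (T : Submonoid (S → α → M))
    (f : S → α → M) (hf : ∀ i, (fun s => Pi.mulSingle i (f s i)) ∈ T) : f ∈ T := by
  have key : ∀ t : Finset α, (fun s i => if i ∈ t then f s i else 1) ∈ T := by
    intro t
    induction t using Finset.induction_on with
    | empty =>
      simp only [Finset.notMem_empty, if_false]
      exact T.one_mem
    | insert a t ha ih =>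
      convert T.mul_mem (hf a) ih using 1
      ext s i
      by_cases h : i = a
      · subst h; simp [ha]
      · simp [h]
  simpa using key Finset.univ

lemma closure_range_toFreeGroup : Subgroup.closure (Set.range (toFreeGroup β)) = ⊤ := by
  rw [eq_top_iff, ← FreeGroup.closure_range_of β]
  refine Subgroup.closure_mono ?_
  rintro _ ⟨b, rfl⟩
  exact ⟨FreeMonoid.of b, by simp⟩

lemma closure_range_toFreeGroupPi [Fintype α] :
    Subgroup.closure (Set.range (toFreeGroupPi α β)) = ⊤ := by
  classical
  have hs : ∀ i (x : FreeGroup β),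
      Pi.mulSingle i x ∈ Subgroup.closure (Set.range (toFreeGroupPi α β)) := by
    intro i x
    have : (⊤ : Subgroup (FreeGroup β)) ≤ (Subgroup.closure (Set.range (toFreeGroupPi α β))).comap
        (MonoidHom.mulSingle (fun _ : α => FreeGroup β) i) := by
      rw [← closure_range_toFreeGroup, Subgroup.closure_le]
      rintro _ ⟨y, rfl⟩
      exact Subgroup.subset_closure ⟨Pi.mulSingle i y, toFreeGroupPi_mulSingle i y⟩
    exact this trivial
  rw [eq_top_iff]
  intro g _
  exact pi_mem_of_mulSingle_mem (S := Unit)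
    ((Subgroup.closure (Set.range (toFreeGroupPi α β))).toSubmonoid.comap
      (Pi.evalMonoidHom (fun _ : Unit => α → FreeGroup β) ())) (fun _ => g) (fun i => hs i (g i))

/-- The power of the free group is the group completion of the power of the free monoid. -/
lemma exists_extension_pi [Fintype α] {Q : Type*} [Group Q] (ψ : (α → FreeMonoid β) →* Q) :
    ∃ ψ' : (α → FreeGroup β) →* Q, ∀ x, ψ' (toFreeGroupPi α β x) = ψ x := by
  classical
  let e (i : α) : FreeGroup β →* Q :=
    FreeGroup.lift fun b => ψ (Pi.mulSingle i (FreeMonoid.of b))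
  have he : ∀ i x, e i (toFreeGroup β x) = ψ (Pi.mulSingle i x) := fun i =>
    DFunLike.congr_fun (f := (e i).comp (toFreeGroup β))
      (g := ψ.comp (MonoidHom.mulSingle (fun _ : α => FreeMonoid β) i))
      (FreeMonoid.hom_eq fun b => by simp [e])
  -- Distinct coordinates commute on letters, and commutation passes to inverses, so the
  -- coordinatewise extensions assemble into one homomorphism.
  have comm : Pairwise fun i j => ∀ x y, Commute (e i x) (e j y) := by
    intro i j hij x y
    have h1 : ∀ a (y : FreeGroup β), Commute (e i (FreeGroup.of a)) (e j y) := by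
      intro a y
      induction y using FreeGroup.induction_on with
      | C1 => simp
      | of b =>
        simp only [e, FreeGroup.lift_apply_of]
        exact (Pi.mulSingle_commute hij _ _).map ψ
      | inv_of b hb => simpa using hb
      | mul x y hx hy => simpa using hx.mul_right hy
    induction x using FreeGroup.induction_on with
    | C1 => simp
    | of a => exact h1 a y
    | inv_of a ha => simpa using ha
    | mul x y hx hy => simpa using hx.mul_left hy
  refine ⟨MonoidHom.noncommPiCoprod e comm, fun x => ?_⟩
  refine DFunLike.congr_fun (f := (MonoidHom.noncommPiCoprod e comm).comp (toFreeGroupPi α β))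
    (g := ψ)
    (MonoidHom.pi_ext fun i y => ?_) x
  simp only [MonoidHom.comp_apply, toFreeGroupPi_mulSingle, MonoidHom.noncommPiCoprod_mulSingle, he]

end FreePowers

/-! ### Extension of polynomial maps to the group completion. -/

section Extension

variable {α β : Type*} [Fintype α] {A : Type*} [AddCommGroup A]

variable (α β A) in
lemma exists_extended_translation (k : ℕ) :
    ∃ ρ : (α → FreeGroup β) →* unipotent (H := α → FreeMonoid β) (A := A) k,
      ∀ a, (ρ (toFreeGroupPi α β a)).1.1 = translation k a := by
  obtain ⟨ρ, hρ⟩ := exists_unipotent (H := α → FreeMonoid β) (A := A) k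
  obtain ⟨ρ', hρ'⟩ := exists_extension_pi ρ
  exact ⟨ρ', fun a => by rw [hρ', hρ]⟩

variable (α β A) in
/-- The extension of right translation on polynomial maps to the group completion. -/
noncomputable def extendedTranslation (k : ℕ) :
    (α → FreeGroup β) →* AddMonoid.End (polyMaps (α → FreeMonoid β) A k) :=
  (Units.coeHom _).comp
    ((unipotent k).subtype.comp (exists_extended_translation α β A k).choose)

lemma extendedTranslation_toFreeGroupPi (k : ℕ) (a : α → FreeMonoid β) :
    extendedTranslation α β A k (toFreeGroupPi α β a) = translation k a :=
  (exists_extended_translation α β A k).choose_spec a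

lemma extendedTranslation_sub_one_mem (k : ℕ) (g : α → FreeGroup β) :
    extendedTranslation α β A k g - 1 ∈ lowering k 1 :=
  ((exists_extended_translation α β A k).choose g).2

/-- The extension of a polynomial map to the group completion. -/
noncomputable def polyExtension {k : ℕ} {φ : (α → FreeMonoid β) → A} (hφ : DevVanish k φ)
    (g : α → FreeGroup β) : A :=
  (extendedTranslation α β A k g ⟨φ, hφ⟩).1 1

lemma polyExtension_toFreeGroupPi {k : ℕ} {φ : (α → FreeMonoid β) → A} (hφ : DevVanish k φ)
    (x : α → FreeMonoid β) : polyExtension hφ (toFreeGroupPi α β x) = φ x := by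
  rw [polyExtension, extendedTranslation_toFreeGroupPi]
  exact congrArg φ (one_mul x)

/-- Evaluating a filtered family of endomorphisms on a polynomial map gives a polynomial map. -/
lemma FilteredDev.devVanish_eval {H K : Type*} [Monoid H] [Monoid K] {k : ℕ}
    (v : polyMaps H A k) (y : H) :
    ∀ {l j : ℕ} {θ : K → AddMonoid.End (polyMaps H A k)},
      FilteredDev (lowering k) l j θ → l + j = k → DevVanish l (fun x => (θ x v).1 y)
  -- Here `j = k`, so the operator lowers the degree by `k` and sends `v` to the zero map.
  | 0, j, θ, h, hj => fun x => h x 0 v (by rw [hj]; exact v.2) y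
  | l + 1, j, θ, h, hj => fun a => FilteredDev.devVanish_eval v y (h.2 a) (by omega)

lemma filteredDev_extendedTranslation_comp {γ : Type*} (k l : ℕ) (f : α → FreeMonoid γ) :
    FilteredDev (lowering k) l 0 (fun g : γ → FreeGroup β =>
      extendedTranslation α β A k (fun i => FreeMonoid.lift g (f i))) := by
  classical
  have anti : Antitone (lowering (H := α → FreeMonoid β) (A := A) k) :=
    fun _ _ h => lowering_antitone k h
  -- By the Leibniz rule the admissible substitutions form a submonoid. A single letter placed in a
  -- single slot depends homomorphically on `g`, and every tuple of words is a product of such.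
  let T : Submonoid ((γ → FreeGroup β) → (α → FreeGroup β)) :=
    { carrier := {w | ∀ l, FilteredDev (lowering k) l 0 fun g => extendedTranslation α β A k (w g)}
      one_mem' := fun l => by
        simpa using FilteredDev.const l (one_mem_lowering k)
      mul_mem' := fun {v w} hv hw l => by
        have := FilteredDev.mul anti mul_mem_lowering (hv l) (hw l)
        convert this using 1
        funext g
        exact map_mul (extendedTranslation α β A k) (v g) (w g) }
  refine pi_mem_of_mulSingle_mem T (fun g i => FreeMonoid.lift g (f i)) (fun i => ?_) l
  generalize f i = x
  induction x using FreeMonoid.inductionOn' with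
  | one =>
    simp only [map_one, Pi.mulSingle_one]
    exact T.one_mem
  | of_mul c x hx =>
    have hc : (fun g : γ → FreeGroup β => (Pi.mulSingle i (g c) : α → FreeGroup β)) ∈ T := fun l =>
      FilteredDev.monoidHom anti mul_mem_lowering (one_mem_lowering k)
        ((extendedTranslation α β A k).comp
          ((MonoidHom.mulSingle (fun _ : α => FreeGroup β) i).comp
            (Pi.evalMonoidHom (fun _ : γ => FreeGroup β) c)))
        (fun g => extendedTranslation_sub_one_mem k _) l
    convert T.mul_mem hc hx using 1
    funext g
    simp [Pi.mulSingle_mul]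

/-- The extension of a polynomial map composed with substitution in words is a polynomial map. -/
lemma devVanish_polyExtension_comp {γ : Type*} {k : ℕ} {φ : (α → FreeMonoid β) → A}
    (hφ : DevVanish k φ) (f : α → FreeMonoid γ) :
    DevVanish k (fun g : γ → FreeGroup β => polyExtension hφ fun i => FreeMonoid.lift g (f i)) :=
  (filteredDev_extendedTranslation_comp k k f).devVanish_eval _ _ rfl

lemma devVanish_polyExtension {k : ℕ} {φ : (α → FreeMonoid β) → A} (hφ : DevVanish k φ) :
    DevVanish k (polyExtension hφ) := by
  have := devVanish_polyExtension_comp hφ (fun i : α => FreeMonoid.of i)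
  simp only [FreeMonoid.lift_eval_of] at this
  exact this

lemma DevVanish.eq_of_toFreeGroupPi {k : ℕ} {φ ψ : (α → FreeGroup β) → A} (hφ : DevVanish k φ)
    (hψ : DevVanish k ψ) (h : ∀ x, φ (toFreeGroupPi α β x) = ψ (toFreeGroupPi α β x)) : φ = ψ :=
  hφ.eq_of_closure (toFreeGroupPi α β) closure_range_toFreeGroupPi hψ h

end Extension

/-! ### Polynomial functors as polynomial maps on Hom sets; restriction along coproduct-preserving
functors. -/

section PolynomialFunctors

variable {C : Type u₁} [Category.{v₁} C] [HasZeroMorphisms C] [HasZeroObject C]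
  [HasBinaryCoproducts C]
variable {D : Type u₂} [Category.{v₂} D] [Abelian D]

omit [HasBinaryCoproducts C] in
lemma IsReduced.map_zero {F : C ⥤ D} (hF : IsReduced F) (X Y : C) : F.map (0 : X ⟶ Y) = 0 := by
  have : (0 : X ⟶ Y) = (0 : X ⟶ (0 : C)) ≫ 0 := by simp
  rw [this, F.map_comp, hF.eq_of_tgt (F.map (0 : X ⟶ (0 : C))) 0, zero_comp]

/-- The inclusion `cr₂F(X, Y) ⟶ F(X ∨ Y)`. -/
noncomputable def crossEffectTwoInclusion (F : C ⥤ D) (Y X : C) :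
    (crossEffectTwo F Y).obj X ⟶ F.obj (X ⨿ Y) :=
  kernel.ι (crossEffectTwoMap F X Y)

instance (F : C ⥤ D) (Y X : C) : Mono (crossEffectTwoInclusion F Y X) :=
  inferInstanceAs (Mono (kernel.ι _))

omit [HasZeroObject C] in
lemma crossEffectTwoInclusion_naturality (F : C ⥤ D) (Y : C) {X X' : C} (f : X ⟶ X') :
    (crossEffectTwo F Y).map f ≫ crossEffectTwoInclusion F Y X' =
      crossEffectTwoInclusion F Y X ≫ F.map (coprod.map f (𝟙 Y)) :=
  kernel.lift_ι _ _ _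

omit [HasZeroObject C] in
lemma crossEffectTwoInclusion_condition (F : C ⥤ D) (Y X : C) :
    crossEffectTwoInclusion F Y X ≫ crossEffectTwoMap F X Y = 0 :=
  kernel.condition _

omit [HasZeroObject C] in
lemma exists_crossEffectTwo_lift (F : C ⥤ D) (Y X : C) {T : D} (t : T ⟶ F.obj (X ⨿ Y))
    (h₁ : t ≫ F.map (retrFst X Y) = 0) (h₂ : t ≫ F.map (retrSnd X Y) = 0) :
    ∃ d : T ⟶ (crossEffectTwo F Y).obj X, d ≫ crossEffectTwoInclusion F Y X = t :=
  ⟨kernel.lift (crossEffectTwoMap F X Y) t (by ext <;> simp [h₁, h₂]), kernel.lift_ι _ _ _⟩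

/-- On `0 ∨ Y` the retraction to `Y` is a split monomorphism, so the kernel vanishes. -/
lemma isReduced_crossEffectTwo (F : C ⥤ D) (Y : C) : IsReduced (crossEffectTwo F Y) := by
  refine (IsZero.iff_id_eq_zero _).2 ?_
  have h : retrSnd (0 : C) Y ≫ coprod.inr = 𝟙 _ := by
    ext
    simp [coprod.inr_desc]
  have hι : crossEffectTwoInclusion F Y 0 ≫ F.map (retrSnd 0 Y) = 0 := by
    have := crossEffectTwoInclusion_condition F Y 0 =≫ biprod.snd
    rwa [Category.assoc, biprod.lift_snd, zero_comp] at this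
  rw [← cancel_mono (crossEffectTwoInclusion F Y 0), Category.id_comp, zero_comp,
    ← Category.comp_id (crossEffectTwoInclusion F Y 0), ← F.map_id, ← h, F.map_comp,
    ← Category.assoc, hι, zero_comp]

lemma isReduced_crossEffectAux (F : C ⥤ D) : ∀ (Y : C) (l : List C),
    IsReduced (crossEffectAux F (Y :: l))
  | Y, [] => isReduced_crossEffectTwo F Y
  | Y, Z :: l => isReduced_crossEffectTwo (crossEffectAux F (Z :: l)) Y

/-- Degree 0 is governed by cr₁ instead of cr₂ and is treated apart: for reduced F, cr₁F is all of
F. -/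
lemma isPolynomialOfDegreeLE_zero_iff {F : C ⥤ D} (hF : IsReduced F) :
    IsPolynomialOfDegreeLE 0 F ↔ ∀ X, IsZero (F.obj X) := by
  have key (X : C) : IsIso (kernel.ι (F.map (0 : X ⟶ (0 : C)))) := by
    rw [hF.map_zero]
    infer_instance
  constructor
  · intro h X
    exact (h X [] rfl).of_iso (asIso (kernel.ι (F.map (0 : X ⟶ (0 : C))))).symm
  · intro h X l hl
    obtain rfl := List.length_eq_zero_iff.1 hl
    let e := asIso (kernel.ι (F.map (0 : X ⟶ (0 : C))))
    exact (h X).of_iso e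

section PolynomialMaps

variable [∀ A B : C, Monoid (A ⟶ B)] (hone : ∀ A B : C, (1 : A ⟶ B) = 0)
  (hmul : ∀ {A B T : C} (f g : A ⟶ B) (h : B ⟶ T), (f * g) ≫ h = (f ≫ h) * (g ≫ h))

include hone hmul

lemma devVanish_succ_of_crossEffectTwo {G : C ⥤ D} (hG : IsReduced G) {k : ℕ}
    (h : ∀ Y A B, DevVanish (k + 1) (fun f : A ⟶ B => (crossEffectTwo G Y).map f)) (A B : C) :
    DevVanish (k + 2) (fun f : A ⟶ B => G.map f) := by
  intro g
  have hdesc : coprod.desc (0 : A ⟶ A) (0 : A ⟶ A) = 0 := by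
    ext <;> simp [coprod.inl_desc, coprod.inr_desc]
  -- The projector of G(A ∨ A) onto cr₂G(A, A): the identity minus the idempotents of the two
  -- summands.
  obtain ⟨d, hd⟩ := exists_crossEffectTwo_lift G A A
    (𝟙 _ - G.map (retrFst A A ≫ coprod.inl) - G.map (retrSnd A A ≫ coprod.inr))
    (by simp [Preadditive.sub_comp, ← G.map_comp, coprod.inl_desc, coprod.inr_desc, hG.map_zero,
      hdesc])
    (by simp [Preadditive.sub_comp, ← G.map_comp, coprod.inl_desc, coprod.inr_desc, hG.map_zero,
      hdesc])
  let δ : A ⟶ A ⨿ A := coprod.inl * coprod.inr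
  have hδ {T : C} (f g : A ⟶ T) : δ ≫ coprod.desc f g = f * g := by
    simp [δ, hmul, coprod.inl_desc, coprod.inr_desc]
  -- Since f * g is `coprod.desc f g` after `δ`, inserting the projector removes exactly G(f) and
  -- G(g). What remains depends on f only through the first variable of cr₂G.
  have hf (f : A ⟶ B) : G.map (f * g) - G.map f =
      G.map δ ≫ d ≫ (crossEffectTwo G A).map f ≫ crossEffectTwoInclusion G A B ≫
        G.map (coprod.desc (𝟙 B) g) + G.map g := by
    have h1 : δ ≫ retrFst A A ≫ f = f := by
      rw [← Category.assoc, hδ, ← hone, mul_one, Category.id_comp]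
    have h2 : δ ≫ retrSnd A A ≫ g = g := by
      rw [← Category.assoc, hδ, ← hone, one_mul, Category.id_comp]
    rw [← Category.assoc ((crossEffectTwo G A).map f), crossEffectTwoInclusion_naturality,
      Category.assoc, ← Category.assoc d, hd, ← G.map_comp (coprod.map f (𝟙 A))]
    simp only [coprod.map_desc, Category.comp_id, Category.id_comp, Preadditive.sub_comp,
      Preadditive.comp_sub, ← G.map_comp, Category.assoc, coprod.inl_desc, coprod.inr_desc, hδ,
      h1, h2]
    abel
  simp only [hf]
  refine DevVanish.add ?_ (DevVanish.const (G.map g) k)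
  convert (h A A B).comp_addMonoidHom
    ((Preadditive.leftComp _ (G.map δ ≫ d)).comp (Preadditive.rightComp _
      (crossEffectTwoInclusion G A B ≫ G.map (coprod.desc (𝟙 B) g)))) using 2 with f
  exact (Category.assoc (G.map δ) d _).symm

/-- Descent from the vanishing cross-effect of order n + 1: each variable removed raises the degree
by one. -/
lemma devVanish_crossEffectAux {F : C ⥤ D} {n : ℕ} (hF : IsPolynomialOfDegreeLE n F) :
    ∀ (k : ℕ) (Y : C) (l : List C), l.length + 1 + k = n →
      ∀ A B, DevVanish (k + 1) (fun f : A ⟶ B => (crossEffectAux F (Y :: l)).map f)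
  | 0, Y, l, hl, A, B => by
    have : IsZero ((crossEffectAux F (Y :: l)).obj A) := hF A (Y :: l) (by simpa using hl)
    intro g f
    exact this.eq_of_src _ _
  | k + 1, Y, l, hl, A, B =>
    devVanish_succ_of_crossEffectTwo hone hmul (isReduced_crossEffectAux F Y l)
      (fun Z => devVanish_crossEffectAux hF k Z (Y :: l) (by simp; omega)) A B

/-- A reduced polynomial functor of degree at most `n` is given by polynomial maps of degree at
most `n` on morphisms. -/
lemma devVanish_map {F : C ⥤ D} {n : ℕ} (hF₀ : IsReduced F) (hF : IsPolynomialOfDegreeLE n F)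
    (A B : C) : DevVanish (n + 1) (fun f : A ⟶ B => F.map f) := by
  cases n with
  | zero =>
    intro g f
    exact ((isPolynomialOfDegreeLE_zero_iff hF₀).1 hF A).eq_of_src _ _
  | succ n =>
    exact devVanish_succ_of_crossEffectTwo hone hmul hF₀
      (fun Y => devVanish_crossEffectAux hone hmul hF n Y [] (by simp [add_comm])) A B

end PolynomialMaps

section Restriction

variable {C' : Type*} [Category* C'] [HasZeroMorphisms C'] [HasZeroObject C']
  [HasBinaryCoproducts C'] (Φ : C ⥤ C') [Φ.PreservesZeroMorphisms]
  [PreservesColimitsOfShape (Discrete WalkingPair) Φ]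

-- Allowing an isomorphism `α` in place of an equality lets the statement be iterated over the
-- variables of a higher cross-effect.
omit [HasZeroObject C] [HasZeroObject C'] in
lemma nonempty_crossEffectTwo_restriction_iso {F : C' ⥤ D} {G : C ⥤ D} (α : Φ ⋙ F ≅ G) (Y : C) :
    Nonempty (Φ ⋙ crossEffectTwo F (Φ.obj Y) ≅ crossEffectTwo G Y) := by
  have h₁ (X : C) : coprodComparison Φ X Y ≫ Φ.map (retrFst X Y) = retrFst _ _ := by
    ext <;> simp [coprodComparison, ← Φ.map_comp, coprod.inl_desc, coprod.inr_desc]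
  have h₂ (X : C) : coprodComparison Φ X Y ≫ Φ.map (retrSnd X Y) = retrSnd _ _ := by
    ext <;> simp [coprodComparison, ← Φ.map_comp, coprod.inl_desc, coprod.inr_desc]
  have h₃ {X X' : C} (f : X ⟶ X') : coprod.map (Φ.map f) (𝟙 (Φ.obj Y)) ≫ coprodComparison Φ X' Y =
      coprodComparison Φ X Y ≫ Φ.map (coprod.map f (𝟙 Y)) := by
    rw [← Φ.map_id, coprodComparison_natural]
  have hα {X X' : C} (f : X ⟶ X') : F.map (Φ.map f) ≫ α.hom.app X' = α.hom.app X ≫ G.map f :=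
    α.hom.naturality f
  let e (X : C) : (crossEffectTwo F (Φ.obj Y)).obj (Φ.obj X) ≅ (crossEffectTwo G Y).obj X :=
    kernel.mapIso _ _ (F.mapIso (asIso (coprodComparison Φ X Y)) ≪≫ α.app (X ⨿ Y))
      (biprod.mapIso (α.app X) (α.app Y)) (by
        ext
        · simp [← hα, ← F.map_comp_assoc, h₁]
        · simp [← hα, ← F.map_comp_assoc, h₂])
  have he (X : C) : (e X).hom ≫ crossEffectTwoInclusion G Y X =
      crossEffectTwoInclusion F (Φ.obj Y) (Φ.obj X) ≫ F.map (coprodComparison Φ X Y) ≫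
        α.hom.app (X ⨿ Y) :=
    kernel.lift_ι _ _ _
  refine ⟨NatIso.ofComponents e fun {X X'} f => ?_⟩
  rw [← cancel_mono (crossEffectTwoInclusion G Y X')]
  simp only [Functor.comp_obj, Functor.comp_map, Category.assoc, he,
    crossEffectTwoInclusion_naturality]
  rw [← Category.assoc, crossEffectTwoInclusion_naturality, ← Category.assoc (e X).hom, he]
  simp only [Category.assoc, ← hα, ← F.map_comp_assoc, h₃]

lemma nonempty_crossEffectAux_restriction_iso (F : C' ⥤ D) : ∀ (Y : C) (l : List C),
    Nonempty (Φ ⋙ crossEffectAux F ((Y :: l).map Φ.obj) ≅ crossEffectAux (Φ ⋙ F) (Y :: l))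
  | Y, [] => nonempty_crossEffectTwo_restriction_iso Φ (Iso.refl _) Y
  | Y, Z :: l =>
    let ⟨α⟩ := nonempty_crossEffectAux_restriction_iso F Z l
    nonempty_crossEffectTwo_restriction_iso Φ α Y

omit [HasBinaryCoproducts C] [Abelian D] [HasBinaryCoproducts C']
  [PreservesColimitsOfShape (Discrete WalkingPair) Φ] in
lemma isReduced_restriction_iff (F : C' ⥤ D) : IsReduced (Φ ⋙ F) ↔ IsReduced F := by
  have e : Φ.obj 0 ≅ 0 := (Φ.map_isZero (isZero_zero C)).isoZero
  exact (F.mapIso e).isZero_iff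

lemma isPolynomialOfDegreeLE_restriction_iff (hΦ : Function.Surjective Φ.obj) {F : C' ⥤ D}
    (hF : IsReduced F) (n : ℕ) :
    IsPolynomialOfDegreeLE n (Φ ⋙ F) ↔ IsPolynomialOfDegreeLE n F := by
  cases n with
  | zero =>
    rw [isPolynomialOfDegreeLE_zero_iff hF,
      isPolynomialOfDegreeLE_zero_iff ((isReduced_restriction_iff Φ F).2 hF), hΦ.forall]
    rfl
  | succ n =>
    have key (X : C) (l : List C) (hl : l.length = n + 1) :
        IsZero (crossEffect (Φ ⋙ F) X l) ↔ IsZero (crossEffect F (Φ.obj X) (l.map Φ.obj)) := by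
      obtain ⟨Y, l, rfl⟩ := List.exists_cons_of_length_eq_add_one hl
      obtain ⟨α⟩ := nonempty_crossEffectAux_restriction_iso Φ F Y l
      exact (α.app X).isZero_iff.symm
    constructor
    · intro h X l hl
      obtain ⟨X, rfl⟩ := hΦ X
      obtain ⟨l, rfl⟩ := (List.map_surjective_iff.2 hΦ) l
      exact (key X l (by simpa using hl)).1 (h X l (by simpa using hl))
    · exact fun h X l hl => (key X l hl).2 (h _ _ (by simpa using hl))

lemma polProperty_restriction_iff (hΦ : Function.Surjective Φ.obj) (F : C' ⥤ D) (n : ℕ) :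
    polProperty C D n (Φ ⋙ F) ↔ polProperty C' D n F := by
  unfold polProperty
  rw [isReduced_restriction_iff]
  exact and_congr_right fun hF => isPolynomialOfDegreeLE_restriction_iff Φ hΦ hF n

end Restriction

end PolynomialFunctors
-- Categories presented by words, and the isomorphism given by restriction.
section Presented

/-- A description of the morphisms of `C` and of the image of `Φ : C ⥤ D` by tuples of words in free
monoids and in free groups respectively, such that `Φ` is group completion of words. -/
structure FreePresentation {C : Type*} [Category* C] [HasZeroMorphisms C] {D : Type*} [Category* D]
    [HasZeroMorphisms D] (Φ : C ⥤ D) where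
  /-- The number of generators of an object. -/
  rank : C → ℕ
  /-- Morphisms of `C` as tuples of words. -/
  mon (A B : C) : (A ⟶ B) ≃ (Fin (rank A) → FreeMonoid (Fin (rank B)))
  /-- Morphisms of `D` as tuples of reduced words. -/
  grp (A B : C) : (Φ.obj A ⟶ Φ.obj B) ≃ (Fin (rank A) → FreeGroup (Fin (rank B)))
  mon_comp {A B T : C} (f : A ⟶ B) (g : B ⟶ T) (i : Fin (rank A)) :
    mon A T (f ≫ g) i = FreeMonoid.lift (mon B T g) (mon A B f i)
  grp_comp {A B T : C} (f : Φ.obj A ⟶ Φ.obj B) (g : Φ.obj B ⟶ Φ.obj T) (i : Fin (rank A)) :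
    grp A T (f ≫ g) i = FreeGroup.lift (grp B T g) (grp A B f i)
  grp_map {A B : C} (f : A ⟶ B) : grp A B (Φ.map f) = toFreeGroupPi _ _ (mon A B f)
  mon_zero (A B : C) : mon A B 0 = 1
  grp_zero (A B : C) : grp A B 0 = 1
  exists_rank (m : ℕ) : ∃ A, rank A = m
  bijective_obj : Function.Bijective Φ.obj

/-- Reduced polynomial functors are given by polynomial maps, for morphism sets identified with
monoids on which postcomposition acts by homomorphisms. -/
lemma devVanish_map_symm {C : Type*} [Category* C] [HasZeroMorphisms C] [HasZeroObject C]
    [HasBinaryCoproducts C] {E : Type*} [Category* E] [Abelian E] {M : C → C → Type*}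
    [∀ A B, Monoid (M A B)] (e : ∀ A B : C, (A ⟶ B) ≃ M A B) (e_zero : ∀ A B, e A B 0 = 1)
    (post : ∀ {A B T : C}, (B ⟶ T) → M A B →* M A T)
    (e_comp : ∀ {A B T : C} (f : A ⟶ B) (g : B ⟶ T), e A T (f ≫ g) = post g (e A B f))
    {n : ℕ} {F : C ⥤ E} (hF : polProperty C E n F) (A B : C) :
    DevVanish (n + 1) (fun x : M A B => F.map ((e A B).symm x)) := by
  let (A B : C) : Monoid (A ⟶ B) := (e A B).monoid
  have h := devVanish_map (C := C) (D := E) (fun A B => (e A B).injective (by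
      rw [e_zero]; exact (e A B).apply_symm_apply 1))
    (fun {A B T} f g h => (e A T).injective (by
      have hm {A B : C} (f g : A ⟶ B) : e A B (f * g) = e A B f * e A B g :=
        (e A B).apply_symm_apply _
      rw [e_comp, hm, hm, map_mul, e_comp, e_comp])) hF.1 hF.2 A B
  exact h.comp_monoidHom ((e A B).mulEquiv.symm : M A B →* (A ⟶ B))

namespace FreePresentation

variable {C : Type u₁} [Category.{v₁} C] [HasZeroMorphisms C]
  {D : Type u₂} [Category.{v₂} D] [HasZeroMorphisms D]
  {E : Type*} [Category* E] [Abelian E] {Φ : C ⥤ D} (p : FreePresentation Φ)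

include p

lemma map_symm (A B : C) (x : Fin (p.rank A) → FreeMonoid (Fin (p.rank B))) :
    Φ.map ((p.mon A B).symm x) = (p.grp A B).symm (toFreeGroupPi _ _ x) := by
  apply (p.grp A B).injective
  rw [p.grp_map, Equiv.apply_symm_apply, Equiv.apply_symm_apply]

lemma preservesZeroMorphisms : Φ.PreservesZeroMorphisms where
  map_zero A B := (p.grp A B).injective (by rw [p.grp_map, p.mon_zero, p.grp_zero, map_one])

/-- The chosen preimage of an object. -/
noncomputable def preim (X : D) : C := (p.bijective_obj.2 X).choose

lemma obj_preim (X : D) : Φ.obj (p.preim X) = X := (p.bijective_obj.2 X).choose_spec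

lemma preim_obj (A : C) : p.preim (Φ.obj A) = A := p.bijective_obj.1 (p.obj_preim _)

section Coproducts

/-- The coproduct concatenates the alphabets, and the same letters give the universal property in
`C` and in `D`. -/
lemma preservesColimit_pair (A B : C) [HasBinaryCoproducts C] : PreservesColimit (pair A B) Φ := by
  obtain ⟨W, hW⟩ := p.exists_rank (p.rank A + p.rank B)
  let iA : Fin (p.rank A) → Fin (p.rank W) := fun i => Fin.cast hW.symm (Fin.castAdd _ i)
  let iB : Fin (p.rank B) → Fin (p.rank W) := fun i => Fin.cast hW.symm (Fin.natAdd _ i)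
  let a : A ⟶ W := (p.mon A W).symm fun i => FreeMonoid.of (iA i)
  let b : B ⟶ W := (p.mon B W).symm fun i => FreeMonoid.of (iB i)
  have ha {T : C} (h : W ⟶ T) (i) : p.mon A T (a ≫ h) i = p.mon W T h (iA i) := by
    simp [p.mon_comp, a]
  have hb {T : C} (h : W ⟶ T) (i) : p.mon B T (b ≫ h) i = p.mon W T h (iB i) := by
    simp [p.mon_comp, b]
  have ha' {T : C} (h : Φ.obj W ⟶ Φ.obj T) (i) :
      p.grp A T (Φ.map a ≫ h) i = p.grp W T h (iA i) := by
    simp [p.grp_comp, p.grp_map, a]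
  have hb' {T : C} (h : Φ.obj W ⟶ Φ.obj T) (i) :
      p.grp B T (Φ.map b ≫ h) i = p.grp W T h (iB i) := by
    simp [p.grp_comp, p.grp_map, b]
  have cases {P : Fin (p.rank W) → Prop} (h₁ : ∀ i, P (iA i)) (h₂ : ∀ i, P (iB i)) (i) : P i := by
    obtain ⟨j, rfl⟩ : ∃ j, Fin.cast hW.symm j = i := ⟨Fin.cast hW i, by simp⟩
    induction j using Fin.addCases with
    | left j => exact h₁ j
    | right j => exact h₂ j
  have glue {S : Type} (x : Fin (p.rank A) → S) (y : Fin (p.rank B) → S) :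
      ∃ z : Fin (p.rank W) → S, (∀ i, z (iA i) = x i) ∧ ∀ i, z (iB i) = y i :=
    ⟨fun i => Fin.addCases x y (Fin.cast hW i), by simp [iA], by simp [iB]⟩
  have hc : IsColimit (BinaryCofan.mk a b) := by
    have ex (s : BinaryCofan A B) : ∃ h : W ⟶ s.pt, a ≫ h = s.inl ∧ b ≫ h = s.inr := by
      obtain ⟨z, h₁, h₂⟩ := glue (p.mon A s.pt s.inl) (p.mon B s.pt s.inr)
      refine ⟨(p.mon W s.pt).symm z, (p.mon _ _).injective (funext fun i => ?_),
        (p.mon _ _).injective (funext fun i => ?_)⟩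
      · rw [ha, Equiv.apply_symm_apply, h₁]
      · rw [hb, Equiv.apply_symm_apply, h₂]
    refine BinaryCofan.isColimitMk (fun s => (ex s).choose) (fun s => (ex s).choose_spec.1)
      (fun s => (ex s).choose_spec.2) fun s m h₁ h₂ => (p.mon _ _).injective (funext ?_)
    refine cases (fun i => ?_) fun i => ?_
    · rw [← ha, ← ha, h₁, (ex s).choose_spec.1]
    · rw [← hb, ← hb, h₂, (ex s).choose_spec.2]
  have hc' : IsColimit (BinaryCofan.mk (Φ.map a) (Φ.map b)) := by
    -- Uniqueness is bundled with existence because `grp` applies only once the cocone point has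
    -- been rewritten as some `Φ.obj T`.
    have ex (s : BinaryCofan (Φ.obj A) (Φ.obj B)) :
        ∃! h : Φ.obj W ⟶ s.pt, Φ.map a ≫ h = s.inl ∧ Φ.map b ≫ h = s.inr := by
      generalize s.inl = f, s.inr = g
      generalize s.pt = T at f g
      obtain ⟨T, rfl⟩ := p.bijective_obj.2 T
      obtain ⟨z, h₁, h₂⟩ := glue (p.grp A T f) (p.grp B T g)
      refine ⟨(p.grp W T).symm z, ⟨(p.grp _ _).injective (funext fun i => ?_),
        (p.grp _ _).injective (funext fun i => ?_)⟩, fun m hm =>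
          (p.grp _ _).injective (funext (cases (fun i => ?_) fun i => ?_))⟩
      · rw [ha', Equiv.apply_symm_apply, h₁]
      · rw [hb', Equiv.apply_symm_apply, h₂]
      · rw [← ha', hm.1, Equiv.apply_symm_apply, h₁]
      · rw [← hb', hm.2, Equiv.apply_symm_apply, h₂]
    exact BinaryCofan.isColimitMk (fun s => (ex s).choose) (fun s => (ex s).choose_spec.1.1)
      (fun s => (ex s).choose_spec.1.2) fun s m h₁ h₂ => (ex s).choose_spec.2 m ⟨h₁, h₂⟩
  exact preservesColimit_of_preserves_colimit_cocone hc
    ((isColimitMapCoconeBinaryCofanEquiv Φ a b).symm hc')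

lemma preservesBinaryCoproducts [HasBinaryCoproducts C] :
    PreservesColimitsOfShape (Discrete WalkingPair) Φ where
  preservesColimit {K} :=
    have := p.preservesColimit_pair (K.obj ⟨WalkingPair.left⟩) (K.obj ⟨WalkingPair.right⟩)
    preservesColimit_of_iso_diagram Φ (diagramIsoPair K).symm

end Coproducts

variable [HasZeroObject C] [HasBinaryCoproducts C] {n : ℕ}

lemma devVanish_mon {F : C ⥤ E} (hF : polProperty C E n F) (A B : C) :
    DevVanish (n + 1) (fun x => F.map ((p.mon A B).symm x)) :=
  devVanish_map_symm p.mon p.mon_zero (fun g => (FreeMonoid.lift (p.mon _ _ g)).compLeft _)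
    (fun f g => funext (p.mon_comp f g)) hF A B

omit [HasZeroObject C] [HasBinaryCoproducts C] in
lemma devVanish_grp [HasZeroObject D] [HasBinaryCoproducts D] {F : D ⥤ E}
    (hF : polProperty D E n F) (A B : C) :
    DevVanish (n + 1) (fun x => F.map ((p.grp A B).symm x)) := by
  -- `grp` covers only objects written as `Φ.obj A`, and `Φ.obj (preim X) = X` is merely
  -- propositional, so Hom sets are conjugated by `eqToHom`.
  let e (X Y : D) : (X ⟶ Y) ≃ (Φ.obj (p.preim X) ⟶ Φ.obj (p.preim Y)) :=
    Iso.homCongr (eqToIso (p.obj_preim X).symm) (eqToIso (p.obj_preim Y).symm)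
  have he {X Y Z : D} (f : X ⟶ Y) (g : Y ⟶ Z) : e X Z (f ≫ g) = e X Y f ≫ e Y Z g := by
    simp [e]
  have key (X Y : D) :
      DevVanish (n + 1) (fun x => F.map ((p.grp (p.preim X) (p.preim Y)).symm x)) := by
    have := devVanish_map_symm (fun X Y => (e X Y).trans (p.grp _ _))
      (fun X Y => by simp [e, p.grp_zero])
      (fun {X Y Z} g => (FreeGroup.lift (p.grp _ _ (e Y Z g))).compLeft _)
      (fun f g => by
        simp only [Equiv.trans_apply, he]
        exact funext (p.grp_comp _ _)) hF X Y
    convert this.comp_addMonoidHom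
      ((Preadditive.leftComp _ (F.map (eqToHom (p.obj_preim X)))).comp (Preadditive.rightComp _
        (F.map (eqToHom (p.obj_preim Y).symm)))) using 2 with x
    change _ = F.map _ ≫ F.map _ ≫ F.map _
    rw [← F.map_comp, ← F.map_comp]
    congr 1
    simp [e]
  have := key (Φ.obj A) (Φ.obj B)
  rwa [p.preim_obj, p.preim_obj] at this

/-- The extension of a polynomial functor on morphisms. -/
noncomputable def extend {F : C ⥤ E} (hF : polProperty C E n F) {A B : C}
    (f : Φ.obj A ⟶ Φ.obj B) : F.obj A ⟶ F.obj B :=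
  polyExtension (p.devVanish_mon hF A B) (p.grp A B f)

lemma extend_map {F : C ⥤ E} (hF : polProperty C E n F) {A B : C} (f : A ⟶ B) :
    p.extend hF (Φ.map f) = F.map f := by
  rw [extend, p.grp_map, polyExtension_toFreeGroupPi, Equiv.symm_apply_apply]

/-- For fixed `f`, both sides are polynomial in `g`, the left one by substitution into the words of
`f`; they agree for `g` coming from `C`. -/
lemma extend_map_comp {F : C ⥤ E} (hF : polProperty C E n F) {A B T : C} (f : A ⟶ B)
    (g : Φ.obj B ⟶ Φ.obj T) : p.extend hF (Φ.map f ≫ g) = F.map f ≫ p.extend hF g := by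
  have h (g : Φ.obj B ⟶ Φ.obj T) : p.grp A T (Φ.map f ≫ g) =
      fun i => FreeMonoid.lift (p.grp B T g) (p.mon A B f i) := by
    funext i
    rw [p.grp_comp, p.grp_map, toFreeGroupPi_apply]
    exact DFunLike.congr_fun (f := (FreeGroup.lift (p.grp B T g)).comp (toFreeGroup _))
      (FreeMonoid.hom_eq fun j => by simp) _
  have := (devVanish_polyExtension_comp (p.devVanish_mon hF A T) (p.mon A B f)).eq_of_toFreeGroupPi
    ((devVanish_polyExtension (p.devVanish_mon hF B T)).comp_addMonoidHom
      (Preadditive.leftComp _ (F.map f))) (fun x => by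
      have h' := h (Φ.map ((p.mon B T).symm x))
      rw [p.grp_map, Equiv.apply_symm_apply] at h'
      rw [← h', ← Φ.map_comp]
      refine (p.extend_map hF _).trans ?_
      rw [F.map_comp, polyExtension_toFreeGroupPi]
      rfl)
  rw [extend, h]
  exact congrFun this (p.grp B T g)

/-- For fixed `g`, postcomposition is a homomorphism in `f`, so both sides are polynomial in `f`;
for `f` coming from `C` they agree by `extend_map_comp`. -/
lemma extend_comp {F : C ⥤ E} (hF : polProperty C E n F) {A B T : C} (f : Φ.obj A ⟶ Φ.obj B)
    (g : Φ.obj B ⟶ Φ.obj T) : p.extend hF (f ≫ g) = p.extend hF f ≫ p.extend hF g := by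
  have := ((devVanish_polyExtension (p.devVanish_mon hF A T)).comp_monoidHom
    ((FreeGroup.lift (p.grp B T g)).compLeft (Fin (p.rank A)))).eq_of_toFreeGroupPi
    ((devVanish_polyExtension (p.devVanish_mon hF A B)).comp_addMonoidHom
      (Preadditive.rightComp _ (p.extend hF g))) (fun x => by
      rw [polyExtension_toFreeGroupPi]
      refine Eq.trans ?_ (p.extend_map_comp hF ((p.mon A B).symm x) g)
      rw [extend]
      congr 1
      funext i
      rw [p.grp_comp, p.grp_map, Equiv.apply_symm_apply]
      rfl)
  rw [extend, show p.grp A T (f ≫ g) = _ from funext (p.grp_comp f g)]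
  exact congrFun this (p.grp A B f)

/-- Reduced polynomial functors extend along `Φ`. -/
lemma exists_extension {F : C ⥤ E} (hF : polProperty C E n F) : ∃ F' : D ⥤ E, Φ ⋙ F' = F := by
  let F' : D ⥤ E :=
    { obj X := F.obj (p.preim X)
      map {X Y} f := p.extend hF (eqToHom (p.obj_preim X) ≫ f ≫ eqToHom (p.obj_preim Y).symm)
      map_id X := by
        rw [← F.map_id, ← p.extend_map hF]
        simp
      map_comp f g := by
        rw [← p.extend_comp]
        simp }
  refine ⟨F', CategoryTheory.Functor.ext (fun A : C => congrArg F.obj (p.preim_obj A))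
    fun (A B : C) f => ?_⟩
  have : eqToHom (p.obj_preim (Φ.obj A)) ≫ Φ.map f ≫ eqToHom (p.obj_preim (Φ.obj B)).symm =
      Φ.map (eqToHom (p.preim_obj A) ≫ f ≫ eqToHom (p.preim_obj B).symm) := by
    simp [eqToHom_map]
  change p.extend hF _ = _
  rw [this, p.extend_map]
  simp [eqToHom_map]

variable [HasZeroObject D] [HasBinaryCoproducts D]

-- Both sides are polynomial in `f` and agree on the image of `Φ`, where `θ` is natural.
omit [HasZeroObject C] [HasBinaryCoproducts C] in
lemma naturality {F G : D ⥤ E} (hF : polProperty D E n F) (hG : polProperty D E n G)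
    (θ : Φ ⋙ F ⟶ Φ ⋙ G) {A B : C} (f : Φ.obj A ⟶ Φ.obj B) :
    F.map f ≫ θ.app B = θ.app A ≫ G.map f := by
  have := ((p.devVanish_grp hF A B).comp_addMonoidHom
    (Preadditive.rightComp _ (θ.app B))).eq_of_toFreeGroupPi
    ((p.devVanish_grp hG A B).comp_addMonoidHom (Preadditive.leftComp _ (θ.app A)))
    (fun x => by
      rw [← p.map_symm]
      exact θ.naturality _)
  have h := congrFun this (p.grp A B f)
  simp only [Equiv.symm_apply_apply] at h
  exact h

omit [HasZeroObject C] [HasBinaryCoproducts C] in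
/-- Natural transformations between restrictions of reduced polynomial functors extend. -/
lemma exists_natTrans_extension {F G : D ⥤ E} (hF : polProperty D E n F) (hG : polProperty D E n G)
    (θ : Φ ⋙ F ⟶ Φ ⋙ G) : ∃ η : F ⟶ G, ∀ A, η.app (Φ.obj A) = θ.app A := by
  refine ⟨⟨fun X => F.map (eqToHom (p.obj_preim X).symm) ≫ θ.app (p.preim X) ≫
    G.map (eqToHom (p.obj_preim X)), fun X Y f => ?_⟩, fun A => ?_⟩
  · have := p.naturality hF hG θ
      (eqToHom (p.obj_preim X) ≫ f ≫ eqToHom (p.obj_preim Y).symm)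
    have h : f ≫ eqToHom (p.obj_preim Y).symm = eqToHom (p.obj_preim X).symm ≫
      eqToHom (p.obj_preim X) ≫ f ≫ eqToHom (p.obj_preim Y).symm := by simp
    rw [← F.map_comp_assoc, h, F.map_comp_assoc, reassoc_of% this]
    simp only [Category.assoc, ← G.map_comp, eqToHom_trans, eqToHom_refl, Category.comp_id]
  · have (A' : C) (h : A' = A) (h' : Φ.obj A' = Φ.obj A) :
        F.map (eqToHom h'.symm) ≫ θ.app A' ≫ G.map (eqToHom h') = θ.app A := by
      subst h
      simp
    exact this _ (p.preim_obj A) _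

variable (E n) in
/-- Restriction along `Φ` as a functor between categories of polynomial functors. -/
def restriction : Pol D E n ⥤ Pol C E n :=
  ObjectProperty.lift _ (ObjectProperty.ι _ ⋙ (Functor.whiskeringLeft C D E).obj Φ) fun F =>
    haveI := p.preservesZeroMorphisms
    haveI := p.preservesBinaryCoproducts
    (polProperty_restriction_iff Φ p.bijective_obj.2 F.obj n).2 F.property

instance : (p.restriction E n).IsIso where
  faithful := ⟨fun {F G η η'} h => by
    ext X : 3
    obtain ⟨A, rfl⟩ := p.bijective_obj.2 X
    exact congrArg (fun θ => θ.hom.app A) h⟩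
  full := ⟨fun {F G} θ => by
    obtain ⟨η, hη⟩ := p.exists_natTrans_extension F.property G.property θ.hom
    refine ⟨⟨η⟩, ?_⟩
    ext A : 3
    exact hη A⟩
  bijective_obj := by
    constructor
    · rintro ⟨F, hF⟩ ⟨G, hG⟩ h
      have h' : Φ ⋙ F = Φ ⋙ G := congrArg ObjectProperty.FullSubcategory.obj h
      congr 1
      -- The equality of restrictions, read as a natural transformation, extends to one with
      -- components `eqToHom`; this forces equality on all morphisms of `D`.
      obtain ⟨η, hη⟩ := p.exists_natTrans_extension hF hG (eqToHom h')
      have hobj (X : D) : F.obj X = G.obj X := by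
        obtain ⟨A, rfl⟩ := p.bijective_obj.2 X
        exact Functor.congr_obj h' A
      have happ (X : D) : η.app X = eqToHom (hobj X) := by
        obtain ⟨A, rfl⟩ := p.bijective_obj.2 X
        rw [hη, eqToHom_app]
      have (X : D) : IsIso (η.app X) := by rw [happ]; infer_instance
      have : IsIso η := NatIso.isIso_of_isIso_app η
      exact Functor.ext_of_iso (asIso η) hobj happ
    · rintro ⟨F, hF⟩
      obtain ⟨F', rfl⟩ := p.exists_extension hF
      have := p.preservesZeroMorphisms
      have := p.preservesBinaryCoproducts
      exact ⟨⟨F', (polProperty_restriction_iff Φ p.bijective_obj.2 F' n).1 hF⟩, rfl⟩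

variable (E n) in
lemma nonempty_isoCat : Nonempty (IsoCat (Pol D E n) (Pol C E n)) :=
  ⟨(p.restriction E n).asIsomorphism⟩

end FreePresentation

end Presented
-- Group completion of free monoids as a functor presented by words.
section InducedPresentation

variable {ι κ : Type*} {X : ι → GrpCat.{u}} {Y : κ → MonCat.{w}} 
  (b : InducedCategory MonCat.{w} Y ≃ InducedCategory GrpCat.{u} X) (r : κ → ℕ)
  (eY : ∀ k, Y k ≃* FreeMonoid (Fin (r k))) (eX : ∀ k, X (b k) ≃* FreeGroup (Fin (r k)))

/-- Morphisms between free monoids as tuples of words. -/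
def monHomEquiv (k l : InducedCategory MonCat.{w} Y) :
    (k ⟶ l) ≃ (Fin (r k) → FreeMonoid (Fin (r l))) where
  toFun f i := eY l (f.hom.hom ((eY k).symm (FreeMonoid.of i)))
  invFun x := ⟨MonCat.ofHom ((eY l).symm.toMonoidHom.comp
    ((FreeMonoid.lift x).comp (eY k).toMonoidHom))⟩
  left_inv f := by
    refine InducedCategory.hom_ext (MonCat.hom_ext (MonoidHom.ext fun y => ?_))
    obtain ⟨x, rfl⟩ := (eY k).symm.surjective y
    exact DFunLike.congr_fun (f := ((eY l).symm.toMonoidHom.comp ((FreeMonoid.lift _).comp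
      (eY k).toMonoidHom)).comp (eY k).symm.toMonoidHom)
      (g := f.hom.hom.comp (eY k).symm.toMonoidHom) (FreeMonoid.hom_eq fun i => by simp) x
  right_inv x := by
    funext i
    simp

lemma monHomEquiv_apply {k l : InducedCategory MonCat.{w} Y} (f : k ⟶ l)
    (x : FreeMonoid (Fin (r k))) :
    eY l (f.hom.hom ((eY k).symm x)) = FreeMonoid.lift (monHomEquiv r eY k l f) x :=
  DFunLike.congr_fun (f := ((eY l).toMonoidHom.comp f.hom.hom).comp (eY k).symm.toMonoidHom)
    (FreeMonoid.hom_eq fun i => by simp [monHomEquiv]) x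

/-- Morphisms between free groups as tuples of reduced words. -/
def grpHomEquiv (k l : InducedCategory MonCat.{w} Y) :
    (b k ⟶ b l) ≃
      (Fin (r k) → FreeGroup (Fin (r l))) where
  toFun f i := eX l (f.hom.hom ((eX k).symm (FreeGroup.of i)))
  invFun x := ⟨GrpCat.ofHom ((eX l).symm.toMonoidHom.comp
    ((FreeGroup.lift x).comp (eX k).toMonoidHom))⟩
  left_inv f := by
    refine InducedCategory.hom_ext (GrpCat.hom_ext (MonoidHom.ext fun y => ?_))
    obtain ⟨x, rfl⟩ := (eX k).symm.surjective y
    exact DFunLike.congr_fun (f := ((eX l).symm.toMonoidHom.comp ((FreeGroup.lift _).comp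
      (eX k).toMonoidHom)).comp (eX k).symm.toMonoidHom)
      (g := f.hom.hom.comp (eX k).symm.toMonoidHom) (FreeGroup.ext_hom _ _ fun i => by simp) x
  right_inv x := by
    funext i
    simp

lemma grpHomEquiv_apply {k l : InducedCategory MonCat.{w} Y}
    (f : b k ⟶ b l)
    (x : FreeGroup (Fin (r k))) :
    eX l (f.hom.hom ((eX k).symm x)) = FreeGroup.lift (grpHomEquiv b r eX k l f) x :=
  DFunLike.congr_fun (f := ((eX l).toMonoidHom.comp f.hom.hom).comp (eX k).symm.toMonoidHom)
    (FreeGroup.ext_hom _ _ fun i => by simp [grpHomEquiv]) x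

lemma monHomEquiv_comp {k l m : InducedCategory MonCat.{w} Y} (f : k ⟶ l) (g : l ⟶ m)
    (i : Fin (r k)) : monHomEquiv r eY k m (f ≫ g) i =
      FreeMonoid.lift (monHomEquiv r eY l m g) (monHomEquiv r eY k l f i) := by
  rw [← monHomEquiv_apply]
  simp [monHomEquiv]

lemma grpHomEquiv_comp {k l m : InducedCategory MonCat.{w} Y}
    (f : b k ⟶ b l)
    (g : b l ⟶ b m)
    (i : Fin (r k)) : grpHomEquiv b r eX k m (f ≫ g) i =
      FreeGroup.lift (grpHomEquiv b r eX l m g) (grpHomEquiv b r eX k l f i) := by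
  rw [← grpHomEquiv_apply]
  simp [grpHomEquiv]

/-- Group completion, as a functor from free monoids to free groups. -/
def groupCompletion : InducedCategory MonCat.{w} Y ⥤ InducedCategory GrpCat.{u} X where
  obj k := b k
  map {k l} f := (grpHomEquiv b r eX k l).symm (toFreeGroupPi _ _ (monHomEquiv r eY k l f))
  map_id k := by
    rw [Equiv.symm_apply_eq]
    funext i
    simp [monHomEquiv, grpHomEquiv]
  map_comp {k l m} f g := by
    rw [Equiv.symm_apply_eq]
    funext i
    rw [grpHomEquiv_comp, Equiv.apply_symm_apply, Equiv.apply_symm_apply, toFreeGroupPi_apply,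
      toFreeGroupPi_apply, monHomEquiv_comp]
    exact DFunLike.congr_fun (f := (toFreeGroup _).comp (FreeMonoid.lift _))
      (g := (FreeGroup.lift _).comp (toFreeGroup _)) (FreeMonoid.hom_eq fun j => by simp) _

/-- The presentation of group completion by words. -/
def freePresentation (hr : Function.Surjective r) :
    FreePresentation (groupCompletion b r eY eX) where
  rank := r
  mon := monHomEquiv r eY
  grp := grpHomEquiv b r eX
  mon_comp := monHomEquiv_comp r eY
  grp_comp := grpHomEquiv_comp b r eX
  grp_map f := Equiv.apply_symm_apply _ _
  mon_zero k l := by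
    funext i
    change eY l 1 = 1
    exact map_one _
  grp_zero k l := by
    funext i
    change eX l 1 = 1
    exact map_one _
  exists_rank := hr
  bijective_obj := b.bijective

end InducedPresentation

/-! ### Counting free structures on a set, for bijectivity on objects. -/

section Counting

open Cardinal

/-- The number of structures on a set transported from a countably infinite, finitely generated
structure equals the number of transporting bijections. -/
lemma mk_transported_structures {S T : Type u} {W : Type} [Monoid W] [Infinite W] [Countable W]
    (op : S → T → T → T) (hop : Function.Injective op)
    (h : ∀ s, ∃ e : T ≃ W, ∀ x y, e (op s x y) = e x * e y)
    (h' : ∀ e : T ≃ W, ∃ s, ∀ x y, e (op s x y) = e x * e y)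
    {m : ℕ} (gen : Fin m → W)
    (hgen : ∀ σ τ : W ≃* W, (∀ i, σ (gen i) = τ (gen i)) → σ = τ) :
    #S = #(T ≃ W) := by
  choose c hc using h
  choose t ht using h'
  have c_inj : Function.Injective c := fun s s' hs => hop <| by
    funext x y
    apply (c s).injective
    rw [hc, hs, hc]
  have le : #S ≤ #(T ≃ W) := mk_le_of_injective c_inj
  rcases isEmpty_or_nonempty (T ≃ W) with he | ⟨⟨e₀⟩⟩
  · have : IsEmpty S := ⟨fun s => he.elim (c s)⟩
    simp
  -- A bijection is determined by the structure it transports and by the automorphism of `W`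
  -- comparing it with the chosen bijection, hence by that automorphism's values on generators. So
  -- each structure comes from countably many bijections.
  let ev (e : T ≃ W) : S × ULift.{u} (Fin m → W) :=
    (t e, ⟨fun i => e ((c (t e)).symm (gen i))⟩)
  let aut (e : T ≃ W) (s : S) (hs : t e = s) : W ≃* W :=
    { (c s).symm.trans e with
      map_mul' := fun x y => by
        have : (c s).symm (x * y) = op s ((c s).symm x) ((c s).symm y) := by
          rw [Equiv.symm_apply_eq, hc]
          simp
        change e ((c s).symm (x * y)) = e _ * e _
        rw [this]
        subst hs
        exact ht e _ _ }
  have ev_inj : Function.Injective ev := by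
    intro e e' hee
    have h₁ : t e = t e' := congrArg Prod.fst hee
    have h₂ (i) : e ((c (t e)).symm (gen i)) = e' ((c (t e')).symm (gen i)) :=
      congrFun (congrArg (fun p => p.2.down) hee) i
    have := hgen (aut e (t e) rfl) (aut e' (t e) h₁.symm) fun i => by
      refine (h₂ i).trans ?_
      change _ = e' ((c (t e)).symm (gen i))
      rw [h₁]
    ext x
    have := DFunLike.congr_fun this (c (t e) x)
    simpa [aut] using this
  -- As there are uncountably many bijections, `#S` is infinite and absorbs the countable factor.
  have lt : ℵ₀ < #(T ≃ W) := by
    have : Infinite T := Infinite.of_injective e₀.symm e₀.symm.injective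
    have : #(T ≃ W) = #(Equiv.Perm T) := mk_congr (Equiv.equivCongr (Equiv.refl T) e₀.symm)
    rw [this, mk_perm_eq_two_power]
    exact (aleph0_le_mk T).trans_lt (cantor _)
  have le' : #(T ≃ W) ≤ #S * ℵ₀ := by
    refine (mk_le_of_injective ev_inj).trans ?_
    rw [mk_prod, lift_id, lift_id]
    gcongr
    exact mk_le_aleph0
  refine le.antisymm (le'.trans (mul_eq_left ?_ ?_ aleph0_ne_zero).le)
  all_goals
    by_contra hS
    refine absurd (lt.trans_le le') (not_lt.2 ?_)
    exact (mul_le_mul_left (not_le.1 hS).le ℵ₀).trans aleph0_mul_aleph0.le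

/-- Monoid structures that are free of rank `m`. -/
abbrev FreeMonStr (T : Type u) (m : ℕ) : Type u :=
  {_s : Monoid T // Nonempty (T ≃* FreeMonoid (Fin m))}

/-- Group structures that are free of rank `m`. -/
abbrev FreeGrpStr (T : Type u) (m : ℕ) : Type u :=
  {_s : Group T // Nonempty (T ≃* FreeGroup (Fin m))}

instance (m : ℕ) : Countable (FreeMonoid (Fin m)) := inferInstanceAs (Countable (List (Fin m)))

instance (m : ℕ) : Infinite (FreeMonoid (Fin (m + 1))) :=
  inferInstanceAs (Infinite (List (Fin (m + 1))))

instance (m : ℕ) : Countable (FreeGroup (Fin m)) :=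
  inferInstanceAs (Countable (Quot _))

lemma mk_freeMonStr (T : Type u) (m : ℕ) :
    #(FreeMonStr T (m + 1)) = #(T ≃ FreeMonoid (Fin (m + 1))) :=
  mk_transported_structures (fun s x y => s.1.mul x y)
    (fun _ _ h => Subtype.ext (Monoid.ext (funext fun x => funext fun y =>
      congrFun (congrFun h x) y)))
    (fun ⟨_, ⟨e⟩⟩ => ⟨e.toEquiv, e.map_mul⟩)
    (fun e => ⟨⟨e.monoid, ⟨@Equiv.mulEquiv _ _ e _⟩⟩, fun _ _ => e.apply_symm_apply _⟩)
    FreeMonoid.of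
    (fun _ _ h => MulEquiv.toMonoidHom_injective (FreeMonoid.hom_eq h))

lemma mk_freeGrpStr (T : Type u) (m : ℕ) :
    #(FreeGrpStr T (m + 1)) = #(T ≃ FreeGroup (Fin (m + 1))) :=
  mk_transported_structures (fun s x y => s.1.mul x y)
    (fun _ _ h => Subtype.ext (Group.ext (funext fun x => funext fun y =>
      congrFun (congrFun h x) y)))
    (fun ⟨_, ⟨e⟩⟩ => ⟨e.toEquiv, e.map_mul⟩)
    (fun e => ⟨⟨e.group, ⟨@Equiv.mulEquiv _ _ e _⟩⟩, fun _ _ => e.apply_symm_apply _⟩)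
    FreeGroup.of
    (fun _ _ h => MulEquiv.toMonoidHom_injective (FreeGroup.ext_hom _ _ h))

/-- In positive rank both sides count the bijections from `T` to a countably infinite set. In rank 0
the free object is trivial, so there is at most one structure of either kind. -/
lemma nonempty_freeStr_equiv (T : Type u) : ∀ m, Nonempty (FreeMonStr T m ≃ FreeGrpStr T m)
  | 0 => by
    have : Unique (FreeMonoid (Fin 0)) := inferInstanceAs (Unique (List (Fin 0)))
    have tM (s : FreeMonStr T 0) : Subsingleton T :=
      let ⟨_, ⟨e⟩⟩ := s; e.toEquiv.subsingleton
    have tG (s : FreeGrpStr T 0) : Subsingleton T :=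
      let ⟨_, ⟨e⟩⟩ := s; e.toEquiv.subsingleton
    have hM : Subsingleton (FreeMonStr T 0) := ⟨fun s _ => Subtype.ext <|
      Monoid.ext <| funext fun _ => funext fun _ => (tM s).elim _ _⟩
    have hG : Subsingleton (FreeGrpStr T 0) := ⟨fun s _ => Subtype.ext <|
      Group.ext <| funext fun _ => funext fun _ => (tG s).elim _ _⟩
    refine ⟨@equivOfSubsingletonOfSubsingleton _ _ hM hG (fun s => ?_) fun s => ?_⟩
    · have h : Nonempty (T ≃ FreeMonoid (Fin 0)) :=
        let ⟨_, ⟨e⟩⟩ := s; ⟨e.toEquiv⟩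
      let e : T ≃ FreeGroup (Fin 0) := h.some.trans (Equiv.ofUnique _ _)
      exact ⟨e.group, ⟨@Equiv.mulEquiv _ _ e _⟩⟩
    · have h : Nonempty (T ≃ FreeGroup (Fin 0)) :=
        let ⟨_, ⟨e⟩⟩ := s; ⟨e.toEquiv⟩
      let e : T ≃ FreeMonoid (Fin 0) := h.some.trans (Equiv.ofUnique _ _)
      exact ⟨e.monoid, ⟨@Equiv.mulEquiv _ _ e _⟩⟩
  | m + 1 => by
    obtain ⟨e⟩ : Nonempty (FreeMonoid (Fin (m + 1)) ≃ FreeGroup (Fin (m + 1))) :=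
      nonempty_equiv_of_countable
    rw [← Cardinal.eq, mk_freeMonStr, mk_freeGrpStr]
    exact mk_congr (Equiv.equivCongr (Equiv.refl T) e)

/-- The rank is recovered by counting homomorphisms to ℤ/2, of which there are 2^m. -/
lemma rank_unique_of_lift_equiv {H : Type*} [Monoid H] {W W' : Type*} [Monoid W]
    [Monoid W'] {m m' : ℕ}
    (e : H ≃* W) (e' : H ≃* W')
    (l : (Fin m → Multiplicative (ZMod 2)) ≃ (W →* Multiplicative (ZMod 2)))
    (l' : (Fin m' → Multiplicative (ZMod 2)) ≃ (W' →* Multiplicative (ZMod 2))) : m = m' := by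
  have f : (W →* Multiplicative (ZMod 2)) ≃ (W' →* Multiplicative (ZMod 2)) :=
    (e.symm.trans e').monoidHomCongrLeftEquiv
  have := Fintype.card_congr ((l.trans f).trans l'.symm)
  simpa [ZMod.card] using this

/-- Free monoids of finite rank as carriers with structures. -/
lemma exists_freeMon_equiv : ∃ e : (Σ p : Type u × ℕ, FreeMonStr p.1 p.2) ≃ FreeMon.{u},
    ∀ x, Nonempty ((e x).obj ≃* FreeMonoid (Fin x.1.2)) := by
  let f (x : Σ p : Type u × ℕ, FreeMonStr p.1 p.2) : FreeMon.{u} :=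
    ⟨@MonCat.of x.1.1 x.2.1, x.1.2, x.2.2⟩
  have hf : Function.Bijective f := by
    constructor
    · rintro ⟨⟨T, m⟩, s, ⟨e⟩⟩ ⟨⟨T', m'⟩, s', ⟨e'⟩⟩ h
      have h₁ : @MonCat.of T s = @MonCat.of T' s' := congrArg ObjectProperty.FullSubcategory.obj h
      injection h₁ with h₂ h₃
      subst h₂
      obtain rfl := eq_of_heq h₃
      obtain rfl := rank_unique_of_lift_equiv e e' FreeMonoid.lift FreeMonoid.lift
      rfl
    · rintro ⟨M, m, hm⟩
      exact ⟨⟨(M, m), M.str, hm⟩, rfl⟩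
  exact ⟨Equiv.ofBijective f hf, fun x => x.2.2⟩

/-- Free groups of finite rank as carriers with structures. -/
lemma exists_freeGrp_equiv : ∃ e : (Σ p : Type u × ℕ, FreeGrpStr p.1 p.2) ≃ FreeGrp.{u},
    ∀ x, Nonempty ((e x).obj ≃* FreeGroup (Fin x.1.2)) := by
  let f (x : Σ p : Type u × ℕ, FreeGrpStr p.1 p.2) : FreeGrp.{u} :=
    ⟨@GrpCat.of x.1.1 x.2.1, x.1.2, x.2.2⟩
  have hf : Function.Bijective f := by
    constructor
    · rintro ⟨⟨T, m⟩, s, ⟨e⟩⟩ ⟨⟨T', m'⟩, s', ⟨e'⟩⟩ h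
      have h₁ : @GrpCat.of T s = @GrpCat.of T' s' := congrArg ObjectProperty.FullSubcategory.obj h
      injection h₁ with h₂ h₃
      subst h₂
      obtain rfl := eq_of_heq h₃
      obtain rfl := rank_unique_of_lift_equiv e e' FreeGroup.lift FreeGroup.lift
      rfl
    · rintro ⟨M, m, hm⟩
      exact ⟨⟨(M, m), M.str, hm⟩, rfl⟩
  exact ⟨Equiv.ofBijective f hf, fun x => x.2.2⟩

/-- There is a rank preserving bijection between the free monoids and the free groups of finite
rank in a universe. -/
lemma exists_rank_preserving_equiv : ∃ b : FreeMon.{u} ≃ FreeGrp.{u}, ∀ M, ∃ m : ℕ,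
    Nonempty (M.obj ≃* FreeMonoid (Fin m)) ∧ Nonempty ((b M).obj ≃* FreeGroup (Fin m)) := by
  obtain ⟨e, he⟩ := exists_freeMon_equiv.{u}
  obtain ⟨e', he'⟩ := exists_freeGrp_equiv.{u}
  -- The carrier and the rank stay fixed; only the structure changes.
  let σ : (Σ p : Type u × ℕ, FreeMonStr p.1 p.2) ≃ Σ p : Type u × ℕ, FreeGrpStr p.1 p.2 :=
    Equiv.sigmaCongrRight fun p => (nonempty_freeStr_equiv p.1 p.2).some
  refine ⟨e.symm.trans (σ.trans e'), fun M => ?_⟩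
  obtain ⟨x, rfl⟩ := e.surjective M
  refine ⟨x.1.2, he x, ?_⟩
  have : (e.symm.trans (σ.trans e')) (e x) = e' (σ x) :=
    congrArg (fun y => e' (σ y)) (e.symm_apply_apply x)
  rw [this]
  exact he' (σ x)

end Counting

end PolFun

theorem mainTheorem2 (n : ℕ) :
    Nonempty (IsoCat (PolFun.Pol PolFun.FreeGrpSk AddCommGrpCat.{w} n)
      (PolFun.Pol PolFun.FreeMonSk AddCommGrpCat.{w} n)) ∧
    Nonempty (IsoCat (PolFun.Pol PolFun.FreeGrp.{u} AddCommGrpCat.{w} n)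
      (PolFun.Pol PolFun.FreeMon.{u} AddCommGrpCat.{w} n)) := by
  constructor
  · exact (PolFun.freePresentation (X := fun m : ℕ => GrpCat.of (FreeGroup (Fin m)))
      (Y := fun m : ℕ => MonCat.of (FreeMonoid (Fin m))) (Equiv.refl ℕ) id
      (fun _ => MulEquiv.refl _) (fun _ => MulEquiv.refl _)
      Function.surjective_id).nonempty_isoCat AddCommGrpCat.{w} n
  · obtain ⟨b, hb⟩ := PolFun.exists_rank_preserving_equiv.{u}
    choose r hM hG using hb
    have hr : Function.Surjective r := fun m => by
      obtain ⟨M, ⟨e⟩⟩ := PolFun.exists_freeMon.{u} m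
      exact ⟨M, PolFun.rank_unique_of_lift_equiv (hM M).some e FreeMonoid.lift FreeMonoid.lift⟩
    have : HasZeroObject (InducedCategory MonCat.{u}
        (ObjectProperty.FullSubcategory.obj : PolFun.FreeMon.{u} → _)) :=
      inferInstanceAs (HasZeroObject PolFun.FreeMon.{u})
    have : HasZeroObject (InducedCategory GrpCat.{u}
        (ObjectProperty.FullSubcategory.obj : PolFun.FreeGrp.{u} → _)) :=
      inferInstanceAs (HasZeroObject PolFun.FreeGrp.{u})
    have : HasBinaryCoproducts (InducedCategory MonCat.{u}
        (ObjectProperty.FullSubcategory.obj : PolFun.FreeMon.{u} → _)) :=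
      inferInstanceAs (HasBinaryCoproducts PolFun.FreeMon.{u})
    have : HasBinaryCoproducts (InducedCategory GrpCat.{u}
        (ObjectProperty.FullSubcategory.obj : PolFun.FreeGrp.{u} → _)) :=
      inferInstanceAs (HasBinaryCoproducts PolFun.FreeGrp.{u})
    exact (PolFun.freePresentation (X := ObjectProperty.FullSubcategory.obj)
      (Y := ObjectProperty.FullSubcategory.obj) b r (fun M => (hM M).some)
      (fun M => (hG M).some) hr).nonempty_isoCat AddCommGrpCat.{w} n
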